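/- **Theorem (Discrete-spectrum bounded case).** Let $X_1,\dots,X_r$ be bounded operators on complex Hilbert spaces $\mathcal H_1,\dots,\mathcal H_r$, and let $\sigma_d(X_j)$ denote the set of isolated points of $\sigma(X_j)$ that are eigenvalues of finite algebraic multiplicity. Suppose that every $X_j$ has purely discrete spectrum in the following sense: with $\sigma_d(X_j)=\{\lambda_{j,k}\}_k$ an enumeration (finite or infinite) of the distinct elements, there are bounded operators $P_{j,k}$ (spectral projectors) and $N_{j,k}$ such that $$P_{j,k}P_{j,\ell}=\delta_{k\ell}P_{j,k},\qquad \operatorname{ran}P_{j,k}=\bigcup_n\ker(X_j-\lambda_{j,k})^n,\qquad P_{j,k}N_{j,k}=N_{j,k}P_{j,k}=N_{j,k},$$ $N_{j,k}$ is nilpotent with nilpotency index $\nu_{j,k}\ge1$, and $$\sum_k P_{j,k}=I,\qquad X_j=\sum_k\left(\lambda_{j,k}P_{j,k}+N_{j,k}\right),$$ where both sums converge unconditionally in the strong operator topology. Let $\mathcal H_\otimes=\mathcal H_1\otimes\cdots\otimes\mathcal H_r$ be the Hilbert space tensor product and $\widetilde X_j=I\otimes\cdots\otimes X_j\otimes\cdots\otimes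 I$. Let $f$ be analytic on an open set $\Omega\subseteq\mathbb C^r$ with $\sigma(X_1)\times\cdots\times\sigma(X_r)\subseteq\Omega$, and set $$f_\otimes(X_1,\dots,X_r)=\frac1{(2\pi i)^r}\int_{\Gamma_1}\cdots\int_{\Gamma_r}f(z_1,\dots,z_r)\prod_{j=1}^r(z_j-\widetilde X_j)^{-1}\,dz_1\cdots dz_r,$$ where, for some open sets $U_j\supseteq\sigma(X_j)$ with $U_1\times\cdots\times U_r\subseteq\Omega$, $\Gamma_j$ is a piecewise $C^1$ cycle in $U_j\setminus\sigma(X_j)$ with winding number $1$ about every point of $\sigma(X_j)$ and $0$ about every point outside $U_j$. Then such cycles exist, the integral does not depend on their choice, $N_{j,k}=(X_j-\lambda_{j,k}I)P_{j,k}$, and $$f_\otimes(X_1,\dots,X_r)=\sum_{k_1,\dots,k_r}\ \sum_{A\subseteq\{1,\dots,r\}}\ \sum_{\substack{1\le q_j\le\nu_{j,k_j}-1\\ (j\in A)}}\frac{\partial_A^{q_A}f(\lambda_{1,k_1},\dots,\lambda_{r,k_r})}{\prod_{j\in A}q_j!}\ \bigotimes_{j=1}^rT_j,\qquad T_j=\begin{cases}P_{j,k_j},&j\notin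 A,\\ N_{j,k_j}^{q_j}P_{j,k_j},&j\in A,\end{cases}$$ where $\partial_A^{q_A}=\prod_{j\in A}\partial^{q_j}/\partial z_j^{q_j}$. Equivalently, $$f_\otimes(X_1,\dots,X_r)=\sum_{k_1,\dots,k_r}\ \sum_{\alpha_1=0}^{\nu_{1,k_1}-1}\cdots\sum_{\alpha_r=0}^{\nu_{r,k_r}-1}\frac{\partial_1^{\alpha_1}\cdots\partial_r^{\alpha_r}f(\lambda_{1,k_1},\dots,\lambda_{r,k_r})}{\alpha_1!\cdots\alpha_r!}\ \bigotimes_{j=1}^rN_{j,k_j}^{\alpha_j}P_{j,k_j}$$ with $N_{j,k_j}^0P_{j,k_j}=P_{j,k_j}$. Both sums over $(k_1,\dots,k_r)$ converge unconditionally in the strong operator topology. -/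

import Mathlib

open scoped TensorProduct Nat
open Filter Topology

noncomputable section

namespace TensorCalculus

universe u v

/-! ### The Hilbert tensor product of finitely many Hilbert spaces -/

/-- A complex inner product space, bundled. -/
structure InnerSpaceBundle : Type (u + 1) where
  carrier : Type u
  [normed : NormedAddCommGroup carrier]
  [inner : InnerProductSpace ℂ carrier]

attribute [instance] InnerSpaceBundle.normed InnerSpaceBundle.inner

/-- The algebraic tensor product `H 0 ⊗ (H 1 ⊗ (⋯ ⊗ (H (r-1) ⊗ ℂ)))` with its inner product.
The empty tensor product is the one-dimensional space. -/
def algTensorBundle : (r : ℕ) → (H : Fin r → Type u) →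
    [∀ j, NormedAddCommGroup (H j)] → [∀ j, InnerProductSpace ℂ (H j)] → InnerSpaceBundle.{u}
  | 0, _, _, _ => ⟨EuclideanSpace ℂ PUnit.{u + 1}⟩
  | r + 1, H, _, _ => ⟨H 0 ⊗[ℂ] (algTensorBundle r fun j => H j.succ).carrier⟩

/-- The algebraic tensor product of the `H j`, an inner product space. -/
abbrev AlgTensor {r : ℕ} (H : Fin r → Type u) [∀ j, NormedAddCommGroup (H j)]
    [∀ j, InnerProductSpace ℂ (H j)] : Type u :=
  (algTensorBundle r H).carrier

/-- The elementary tensor `u 0 ⊗ ⋯ ⊗ u (r-1)` in the algebraic tensor product. -/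
def algTprod : {r : ℕ} → {H : Fin r → Type u} → [∀ j, NormedAddCommGroup (H j)] →
    [∀ j, InnerProductSpace ℂ (H j)] → (∀ j, H j) → AlgTensor H
  | 0, _, _, _, _ => (EuclideanSpace.single PUnit.unit (1 : ℂ) : EuclideanSpace ℂ PUnit.{u + 1})
  | _ + 1, H, _, _, x =>
      (x 0 ⊗ₜ[ℂ] (algTprod (H := fun j => H j.succ) fun j => x j.succ) :
        H 0 ⊗[ℂ] AlgTensor fun j => H j.succ)

/-- The operator `T 0 ⊗ ⋯ ⊗ T (r-1)` on the algebraic tensor product. -/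
def algTensorMap : {r : ℕ} → {H : Fin r → Type u} → [∀ j, NormedAddCommGroup (H j)] →
    [∀ j, InnerProductSpace ℂ (H j)] → (∀ j, H j →L[ℂ] H j) → (AlgTensor H →L[ℂ] AlgTensor H)
  | 0, _, _, _, _ => ContinuousLinearMap.id ℂ (EuclideanSpace ℂ PUnit.{u + 1})
  | _ + 1, H, _, _, T =>
      (TensorProduct.mapL (T 0) (algTensorMap (H := fun j => H j.succ) fun j => T j.succ) :
        (H 0 ⊗[ℂ] AlgTensor fun j => H j.succ) →L[ℂ] (H 0 ⊗[ℂ] AlgTensor fun j => H j.succ))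

/-- The Hilbert tensor product: the completion of the algebraic one. -/
abbrev HilbertTensor {r : ℕ} (H : Fin r → Type u) [∀ j, NormedAddCommGroup (H j)]
    [∀ j, InnerProductSpace ℂ (H j)] : Type u :=
  UniformSpace.Completion (AlgTensor H)

section Tensor

variable {r : ℕ} {H : Fin r → Type u} [∀ j, NormedAddCommGroup (H j)]
  [∀ j, InnerProductSpace ℂ (H j)]

/-- The elementary tensor `u 0 ⊗ ⋯ ⊗ u (r-1)` in the Hilbert tensor product. -/
def tprod (x : ∀ j, H j) : HilbertTensor H := ((algTprod x : AlgTensor H) : HilbertTensor H)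

/-- The bounded operator `T 0 ⊗ ⋯ ⊗ T (r-1)` on the Hilbert tensor product. -/
def tensorMap (T : ∀ j, H j →L[ℂ] H j) : HilbertTensor H →L[ℂ] HilbertTensor H :=
  (algTensorMap T).completion

theorem inner_algTprod : ∀ {r : ℕ} {H : Fin r → Type u} [∀ j, NormedAddCommGroup (H j)]
    [∀ j, InnerProductSpace ℂ (H j)] (x y : ∀ j, H j),
    inner ℂ (algTprod x : AlgTensor H) (algTprod y) = ∏ j, inner ℂ (x j) (y j) := by
  intro r
  induction r with
  | zero =>
    intro H _ _ x y
    change inner ℂ (EuclideanSpace.single PUnit.unit (1 : ℂ) : EuclideanSpace ℂ PUnit.{u + 1})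
      (EuclideanSpace.single PUnit.unit (1 : ℂ)) = _
    simp
  | succ r ih =>
    intro H _ _ x y
    rw [Fin.prod_univ_succ, ← ih]
    exact TensorProduct.inner_tmul (𝕜 := ℂ) (E := H 0) (F := AlgTensor fun j => H j.succ) _ _ _ _

/-- The inner product of elementary tensors is the product of the inner products. -/
theorem inner_tprod (x y : ∀ j, H j) :
    inner ℂ (tprod x : HilbertTensor H) (tprod y) = ∏ j, inner ℂ (x j) (y j) := by
  rw [← inner_algTprod]
  exact UniformSpace.Completion.inner_coe _ _

theorem algTensorMap_algTprod : ∀ {r : ℕ} {H : Fin r → Type u} [∀ j, NormedAddCommGroup (H j)]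
    [∀ j, InnerProductSpace ℂ (H j)] (T : ∀ j, H j →L[ℂ] H j) (x : ∀ j, H j),
    algTensorMap T (algTprod x) = algTprod fun j => T j (x j) := by
  intro r
  induction r with
  | zero => intro H _ _ T x; rfl
  | succ r ih =>
    intro H _ _ T x
    refine (TensorProduct.mapL_tmul _ _ _ _).trans ?_
    exact congrArg (fun w => (T 0 (x 0) ⊗ₜ[ℂ] w : H 0 ⊗[ℂ] AlgTensor fun j => H j.succ))
      (ih (H := fun j => H j.succ) (fun j => T j.succ) fun j => x j.succ)

/-- `T 0 ⊗ ⋯ ⊗ T (r-1)` acts componentwise on elementary tensors. -/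
theorem tensorMap_tprod (T : ∀ j, H j →L[ℂ] H j) (x : ∀ j, H j) :
    tensorMap T (tprod x) = tprod fun j => T j (x j) := by
  unfold tprod
  rw [← algTensorMap_algTprod]
  exact ContinuousLinearMap.completion_apply_coe _ _

theorem span_algTprod : ∀ {r : ℕ} {H : Fin r → Type u} [∀ j, NormedAddCommGroup (H j)]
    [∀ j, InnerProductSpace ℂ (H j)],
    Submodule.span ℂ (Set.range (algTprod : (∀ j, H j) → AlgTensor H)) = ⊤ := by
  intro r
  induction r with
  | zero =>
    intro H _ _
    refine Submodule.eq_top_iff'.2 fun w => ?_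
    have hw : w = (show EuclideanSpace ℂ PUnit.{u + 1} from w) PUnit.unit •
        algTprod (H := H) (fun j => j.elim0) := by
      change (show EuclideanSpace ℂ PUnit.{u + 1} from w) = _ •
        (EuclideanSpace.single PUnit.unit (1 : ℂ) : EuclideanSpace ℂ PUnit.{u + 1})
      ext i
      change _ = _ * (EuclideanSpace.single PUnit.unit (1 : ℂ) : EuclideanSpace ℂ PUnit.{u + 1}) i
      simp
    rw [hw]
    exact Submodule.smul_mem _ _ (Submodule.subset_span ⟨_, rfl⟩)
  | succ r ih =>
    intro H _ _
    have key : ∀ (a : H 0) (b : AlgTensor fun j => H j.succ),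
        (a ⊗ₜ[ℂ] b : H 0 ⊗[ℂ] AlgTensor fun j => H j.succ) ∈
        (Submodule.span ℂ (Set.range (algTprod : (∀ j, H j) → AlgTensor H)) :
          Submodule ℂ (AlgTensor H)) := by
      intro a b
      have hb : b ∈ Submodule.span ℂ (Set.range
          (algTprod : (∀ j : Fin r, H j.succ) → AlgTensor fun j => H j.succ)) := by
        rw [ih]; trivial
      induction hb using Submodule.span_induction with
      | mem b hb =>
        obtain ⟨y, rfl⟩ := hb
        exact Submodule.subset_span ⟨Fin.cons a y, rfl⟩
      | zero =>
        rw [TensorProduct.tmul_zero]; exact Submodule.zero_mem _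
      | add b c _ _ hb hc =>
        rw [TensorProduct.tmul_add]; exact Submodule.add_mem _ hb hc
      | smul c b _ hb =>
        rw [TensorProduct.tmul_smul]; exact Submodule.smul_mem _ c hb
    refine Submodule.eq_top_iff'.2 fun w => ?_
    exact TensorProduct.induction_on (motive := fun w : H 0 ⊗[ℂ] AlgTensor fun j => H j.succ =>
      w ∈ (Submodule.span ℂ (Set.range (algTprod : (∀ j, H j) → AlgTensor H)) :
          Submodule ℂ (AlgTensor H))) w
      (Submodule.zero_mem _) key fun _ _ h k => Submodule.add_mem _ h k

/-- The elementary tensors span a dense subspace. -/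
theorem dense_span_tprod :
    Dense (Submodule.span ℂ (Set.range (tprod : (∀ j, H j) → HilbertTensor H)) :
      Set (HilbertTensor H)) := by
  refine (UniformSpace.Completion.denseRange_coe (α := AlgTensor H)).mono ?_
  rintro _ ⟨w, rfl⟩
  have hw : w ∈ Submodule.span ℂ (Set.range (algTprod : (∀ j, H j) → AlgTensor H)) := by
    rw [span_algTprod]; trivial
  have h := Submodule.mem_map_of_mem
    (f := (UniformSpace.Completion.toComplL (𝕜 := ℂ) (E := AlgTensor H)).toLinearMap) hw
  rw [Submodule.map_span, ← Set.range_comp] at h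
  exact h

/-- The lifted operator `I ⊗ ⋯ ⊗ I ⊗ T ⊗ I ⊗ ⋯ ⊗ I`, with `T` in position `j`. -/
def lift (j : Fin r) (T : H j →L[ℂ] H j) : HilbertTensor H →L[ℂ] HilbertTensor H :=
  tensorMap (Function.update (fun i => ContinuousLinearMap.id ℂ (H i)) j T)

end Tensor

/-! ### Contours -/

/-- A piecewise `C¹` cycle in the plane: finitely many `C¹` arcs, parametrized by `[0, 1]`, which
fit together to closed curves (the end of each arc is the start of the arc `next`, and `next` is
a permutation of the arcs). -/
structure Cycle where
  n : ℕ
  arc : Fin n → ℝ → ℂ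
  contDiff : ∀ i, ContDiff ℝ 1 (arc i)
  next : Equiv.Perm (Fin n)
  closed : ∀ i, arc i 1 = arc (next i) 0

/-- The winding number of a cycle about `w`. -/
def Cycle.index (Γ : Cycle) (w : ℂ) : ℂ :=
  (2 * Real.pi * Complex.I)⁻¹ *
    ∑ i, ∫ t in (0 : ℝ)..1, deriv (Γ.arc i) t / (Γ.arc i t - w)

/-- `Γ` surrounds `K` in `U`: it runs in `U \ K`, winds once around every point of `K` and does not
wind around any point outside `U`. -/
structure Cycle.Surrounds (Γ : Cycle) (K U : Set ℂ) : Prop where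
  mem : ∀ i, ∀ t ∈ Set.Icc (0 : ℝ) 1, Γ.arc i t ∈ U \ K
  index_eq_one : ∀ w ∈ K, Γ.index w = 1
  index_eq_zero : ∀ w ∉ U, Γ.index w = 0

/-- The multiple contour integral `∫_{Γ 0} ⋯ ∫_{Γ (r-1)} F(z) dz`. -/
def contourIntegral {r : ℕ} {E : Type*} [NormedAddCommGroup E] [NormedSpace ℂ E]
    (Γ : Fin r → Cycle) (F : (Fin r → ℂ) → E) : E :=
  ∑ c : ∀ j, Fin (Γ j).n, ∫ t in Set.Icc (0 : Fin r → ℝ) 1,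
    (∏ j, deriv ((Γ j).arc (c j)) (t j)) • F fun j => (Γ j).arc (c j) (t j)

/-! ### The tensor-lifted functional calculus -/

section Calculus

variable {r : ℕ} {H : Fin r → Type u} [∀ j, NormedAddCommGroup (H j)]
  [∀ j, InnerProductSpace ℂ (H j)]

/-- Contours `Γ j` around `σ(X j)`, suited to functions that are analytic on `Ω`: they surround
`σ(X j)` in open sets `U j` whose product lies in `Ω`. -/
def IsAdmissible (X : ∀ j, H j →L[ℂ] H j) (Ω : Set (Fin r → ℂ)) (Γ : Fin r → Cycle) : Prop :=
  ∃ U : Fin r → Set ℂ, (∀ j, IsOpen (U j)) ∧ (∀ j, spectrum ℂ (X j) ⊆ U j) ∧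
    Set.univ.pi U ⊆ Ω ∧ ∀ j, (Γ j).Surrounds (spectrum ℂ (X j)) (U j)

/-- The joint Cauchy integral of `f` for the commuting lifted operators:
`(2πi)⁻ʳ ∫_{Γ 0} ⋯ ∫_{Γ (r-1)} f(z) ∏_j (z_j - X̃_j)⁻¹ dz`. -/
def cauchyIntegral (X : ∀ j, H j →L[ℂ] H j) (f : (Fin r → ℂ) → ℂ) (Γ : Fin r → Cycle) :
    HilbertTensor H →L[ℂ] HilbertTensor H :=
  ((2 * Real.pi * Complex.I : ℂ) ^ r)⁻¹ • contourIntegral Γ fun z =>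
    f z • (List.ofFn fun j => resolvent (lift j (X j)) (z j)).prod

open Classical in
/-- The operator `f_⊗(X_1, …, X_r)` for a function `f` that is analytic on `Ω`: the joint Cauchy
integral over admissible contours (over one of them; that such contours exist and that the integral
is the same for all of them is not part of this definition). -/
def tensorCalculus (X : ∀ j, H j →L[ℂ] H j) (Ω : Set (Fin r → ℂ)) (f : (Fin r → ℂ) → ℂ) :
    HilbertTensor H →L[ℂ] HilbertTensor H :=
  if h : ∃ Γ, IsAdmissible X Ω Γ then cauchyIntegral X f h.choose else 0

/-- The partial derivative `∂f/∂z_j`. -/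
def partialDeriv (j : Fin r) (f : (Fin r → ℂ) → ℂ) (z : Fin r → ℂ) : ℂ :=
  deriv (fun w => f (Function.update z j w)) (z j)

/-- The mixed partial derivative `∂_1^{α_1} ⋯ ∂_r^{α_r} f`. -/
def mixedPartial (α : Fin r → ℕ) (f : (Fin r → ℂ) → ℂ) : (Fin r → ℂ) → ℂ :=
  (List.finRange r).foldr (fun j g => (partialDeriv j)^[α j] g) f

end Calculus

/-! ### Discrete spectrum and the projector–nilpotent decomposition -/

section Decomposition

variable {H : Type u} [NormedAddCommGroup H] [InnerProductSpace ℂ H]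

/-- The generalized eigenspace `⋃ₙ ker (X - μ)ⁿ`. -/
def genEigenspace (X : H →L[ℂ] H) (μ : ℂ) : Submodule ℂ H :=
  Module.End.maxGenEigenspace (X : H →ₗ[ℂ] H) μ

/-- The discrete spectrum: the eigenvalues that are isolated points of the spectrum and have finite
algebraic multiplicity. -/
def discreteSpectrum (X : H →L[ℂ] H) : Set ℂ :=
  {μ | Module.End.HasEigenvalue (X : H →ₗ[ℂ] H) μ ∧ (∀ᶠ z in 𝓝[≠] μ, z ∉ spectrum ℂ X) ∧
    FiniteDimensional ℂ (genEigenspace X μ)}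

/-- A global projector–nilpotent decomposition `X = ∑ₖ (λₖ Pₖ + Nₖ)` over the discrete spectrum,
with `∑ₖ Pₖ = I`; both sums converge in the strong operator topology. -/
structure ProjectorNilpotentDecomposition (X : H →L[ℂ] H) (ι : Type v) where
  /-- The distinct eigenvalues `λₖ`. -/
  ev : ι → ℂ
  ev_injective : Function.Injective ev
  range_ev : Set.range ev = discreteSpectrum X
  /-- The spectral projectors `Pₖ`. -/
  P : ι → H →L[ℂ] H
  /-- The nilpotent parts `Nₖ`. -/
  N : ι → H →L[ℂ] H
  range_P : ∀ k, LinearMap.range (P k : H →ₗ[ℂ] H) = genEigenspace X (ev k)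
  P_mul_self : ∀ k, P k * P k = P k
  P_mul_of_ne : ∀ k l, k ≠ l → P k * P l = 0
  P_mul_N : ∀ k, P k * N k = N k
  N_mul_P : ∀ k, N k * P k = N k
  isNilpotent_N : ∀ k, IsNilpotent (N k)
  hasSum_P : ∀ x, HasSum (fun k => P k x) x
  hasSum_X : ∀ x, HasSum (fun k => (ev k • P k + N k) x) (X x)

/-- The nilpotency index `νₖ` of `Nₖ`. -/
def ProjectorNilpotentDecomposition.ν {X : H →L[ℂ] H} {ι : Type v}
    (D : ProjectorNilpotentDecomposition X ι) (k : ι) : ℕ :=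
  nilpotencyClass (D.N k)

end Decomposition

end TensorCalculus

end

noncomputable section

namespace TensorCalculus

universe u v

/-! ### Integrals along cycles -/

namespace Cycle

/-! For a multi-index `k` let `R k` be the tensor product of the projectors `P_{j,k_j}`. These are
mutually annihilating idempotents, and they sum strongly and unconditionally to the identity
(`hasSum_tensorMap`). Applying the bounded Cauchy integral to `w = ∑ R k w` term by term leaves its
value on each `R k`. There every resolvent is the finite sum `∑ (z - λ)⁻¹ ^ (m + 1) N ^ m P`
(`resolvent_mul_P`), so the integral becomes a finite sum of scalar Cauchy integrals, and these are
mixed derivatives of `f` divided by factorials (`contourIntegral_mul_prod_inv_sub_pow`). The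
resulting series does not mention the contours, so independence of the contours follows from
uniqueness of sums.

Unconditional convergence over multi-indices is the delicate point, because the projectors need not
be orthogonal. Banach–Steinhaus bounds all signed finite sums of the `P_{j,k}`. A good choice of
signs turns this into the square function bound `∑ ‖P_{j,k} x‖ ^ 2 ≤ C ^ 2 * ‖x‖ ^ 2`, and the same
holds for the adjoints. Both bounds pass to products of lifted operators, and for idempotents the
two together bound every finite partial sum (`norm_sum_le_of_sum_norm_sq_le`). Convergence then only
has to be checked on a set with dense span.

Contours are boundaries of finite unions of grid squares (`Grid.exists_cycle`). For them Cauchy's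
theorem reduces to squares lying in discs. For an arbitrary admissible cycle it follows by writing
the function as a Cauchy integral over a surrounding grid cycle and exchanging the two integrals
(`Cycle.integral_eq_zero_of_index_eq_zero`). -/

/-- The integral of `F` along a cycle. -/
def integral (Γ : Cycle) (F : ℂ → ℂ) : ℂ :=
  ∑ i, ∫ t in (0 : ℝ)..1, deriv (Γ.arc i) t * F (Γ.arc i t)

/-- The set of points that a cycle runs through. -/
def image (Γ : Cycle) : Set ℂ := ⋃ i, Γ.arc i '' Set.Icc 0 1

variable {Γ : Cycle}

theorem arc_mem_image (i : Fin Γ.n) {t : ℝ} (ht : t ∈ Set.Icc (0 : ℝ) 1) : Γ.arc i t ∈ Γ.image :=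
  Set.mem_iUnion.2 ⟨i, t, ht, rfl⟩

theorem isCompact_image (Γ : Cycle) : IsCompact Γ.image :=
  isCompact_iUnion fun i => isCompact_Icc.image (Γ.contDiff i).continuous

theorem hasDerivAt_arc (Γ : Cycle) (i : Fin Γ.n) (t : ℝ) :
    HasDerivAt (Γ.arc i) (deriv (Γ.arc i) t) t :=
  ((Γ.contDiff i).differentiable one_ne_zero t).hasDerivAt

theorem continuous_deriv_arc (Γ : Cycle) (i : Fin Γ.n) : Continuous (deriv (Γ.arc i)) :=
  (Γ.contDiff i).continuous_deriv le_rfl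

theorem index_eq (Γ : Cycle) (w : ℂ) :
    Γ.index w = (2 * Real.pi * Complex.I)⁻¹ * Γ.integral fun z => (z - w)⁻¹ := by
  simp only [index, integral, div_eq_mul_inv]

theorem integral_inv_sub (Γ : Cycle) (w : ℂ) :
    Γ.integral (fun z => (z - w)⁻¹) = 2 * Real.pi * Complex.I * Γ.index w := by
  rw [index_eq, mul_inv_cancel_left₀ Complex.two_pi_I_ne_zero]

theorem integral_congr {F G : ℂ → ℂ} (h : Set.EqOn F G Γ.image) : Γ.integral F = Γ.integral G := by
  refine Finset.sum_congr rfl fun i _ => intervalIntegral.integral_congr fun t ht => ?_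
  rw [Set.uIcc_of_le zero_le_one] at ht
  simp only [h (arc_mem_image i ht)]

theorem continuousOn_integrand {F : ℂ → ℂ} (hF : ContinuousOn F Γ.image) (i : Fin Γ.n) :
    ContinuousOn (fun t : ℝ => deriv (Γ.arc i) t * F (Γ.arc i t)) (Set.Icc 0 1) :=
  (Γ.continuous_deriv_arc i).continuousOn.mul
    (hF.comp (Γ.contDiff i).continuous.continuousOn fun _ ht => arc_mem_image i ht)

theorem intervalIntegrable_integrand {F : ℂ → ℂ} (hF : ContinuousOn F Γ.image) (i : Fin Γ.n) :
    IntervalIntegrable (fun t : ℝ => deriv (Γ.arc i) t * F (Γ.arc i t))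
      MeasureTheory.volume 0 1 := by
  refine ContinuousOn.intervalIntegrable ?_
  rw [Set.uIcc_of_le zero_le_one]
  exact continuousOn_integrand hF i

theorem integral_add {F G : ℂ → ℂ} (hF : ContinuousOn F Γ.image) (hG : ContinuousOn G Γ.image) :
    Γ.integral (fun z => F z + G z) = Γ.integral F + Γ.integral G := by
  simp only [integral, mul_add]
  rw [← Finset.sum_add_distrib]
  exact Finset.sum_congr rfl fun i _ => intervalIntegral.integral_add
    (intervalIntegrable_integrand hF i) (intervalIntegrable_integrand hG i)

theorem integral_const_mul (c : ℂ) (F : ℂ → ℂ) :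
    Γ.integral (fun z => c * F z) = c * Γ.integral F := by
  simp only [integral, Finset.mul_sum]
  refine Finset.sum_congr rfl fun i _ => ?_
  rw [← intervalIntegral.integral_const_mul]
  exact intervalIntegral.integral_congr fun t _ => by ring

/-- A function with a primitive has integral zero along a cycle. -/
theorem integral_eq_zero_of_hasDerivAt {F G : ℂ → ℂ} (hF : ContinuousOn F Γ.image)
    (hG : ∀ z ∈ Γ.image, HasDerivAt G (F z) z) : Γ.integral F = 0 := by
  have h : ∀ i, ∫ t in (0 : ℝ)..1, deriv (Γ.arc i) t * F (Γ.arc i t) =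
      G (Γ.arc i 1) - G (Γ.arc i 0) := fun i => by
    refine intervalIntegral.integral_eq_sub_of_hasDerivAt (f := fun t => G (Γ.arc i t))
      (fun t ht => ?_) (intervalIntegrable_integrand hF i)
    rw [Set.uIcc_of_le zero_le_one] at ht
    rw [mul_comm]
    exact (hG _ (arc_mem_image i ht)).comp t (Γ.hasDerivAt_arc i t)
  -- The end of each arc is the start of arc `next i`, so the endpoint terms cancel after reindexing
  -- by the permutation.
  simp only [integral, h, Γ.closed, Finset.sum_sub_distrib]
  rw [Equiv.sum_comp Γ.next fun i => G (Γ.arc i 0), sub_self]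

/-- A nonpositive real quotient `-c` would give `z = (v + c w) / (1 + c)`, a point of the segment.
Hence the principal logarithm of the quotient is a primitive off the segment. -/
theorem div_mem_slitPlane {z v w : ℂ} (h : z ∉ segment ℝ v w) :
    (z - v) / (z - w) ∈ Complex.slitPlane := by
  by_contra hn
  rw [Complex.mem_slitPlane_iff_not_le_zero, not_not, Complex.le_def] at hn
  obtain ⟨h1, h2⟩ := hn
  simp only [Complex.zero_re, Complex.zero_im] at h1 h2
  set q := (z - v) / (z - w) with hq
  have hw : z - w ≠ 0 := fun h0 => h (by rw [sub_eq_zero.1 h0]; exact right_mem_segment ℝ v w)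
  have hv : z - v = (q.re : ℂ) * (z - w) := by
    have : (q.re : ℂ) = q := by apply Complex.ext <;> simp [h2]
    rw [this, hq, div_mul_cancel₀ _ hw]
  apply h
  have h3 : (0 : ℝ) < 1 - q.re := by linarith
  refine ⟨1 / (1 - q.re), -q.re / (1 - q.re), by positivity,
    div_nonneg (by linarith) h3.le, by field_simp; ring, ?_⟩
  have h4 : (1 - q.re : ℂ) ≠ 0 := by exact_mod_cast h3.ne'
  simp only [Complex.real_smul]
  push_cast
  field_simp
  linear_combination -hv

theorem hasDerivAt_log_div {z v w : ℂ} (h : z ∉ segment ℝ v w) :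
    HasDerivAt (fun z => Complex.log ((z - v) / (z - w))) ((z - v)⁻¹ - (z - w)⁻¹) z := by
  have hv : z - v ≠ 0 := fun h0 => h (by rw [sub_eq_zero.1 h0]; exact left_mem_segment ℝ v w)
  have hw : z - w ≠ 0 := fun h0 => h (by rw [sub_eq_zero.1 h0]; exact right_mem_segment ℝ v w)
  have h1 : HasDerivAt (fun z => (z - v) / (z - w))
      ((1 * (z - w) - (z - v) * 1) / (z - w) ^ 2) z :=
    ((hasDerivAt_id z).sub_const v).div ((hasDerivAt_id z).sub_const w) hw
  convert h1.clog (div_mem_slitPlane h) using 1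
  field_simp

theorem continuousOn_inv_sub {S : Set ℂ} {w : ℂ} (h : w ∉ S) :
    ContinuousOn (fun z : ℂ => (z - w)⁻¹) S :=
  (continuousOn_id.sub continuousOn_const).inv₀ fun z hz h0 => h (by
    rwa [← show z = w from sub_eq_zero.1 h0])

/-- The index is the same at the two ends of a segment that does not meet the cycle. -/
theorem index_eq_of_segment {v w : ℂ} (h : ∀ z ∈ Γ.image, z ∉ segment ℝ v w) :
    Γ.index v = Γ.index w := by
  have hv : v ∉ Γ.image := fun hv => h v hv (left_mem_segment ℝ v w)
  have hw : w ∉ Γ.image := fun hw => h w hw (right_mem_segment ℝ v w)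
  have hw' : ContinuousOn (fun z : ℂ => (-1) * (z - w)⁻¹) Γ.image :=
    continuousOn_const.mul (continuousOn_inv_sub hw)
  have h0 : Γ.integral (fun z => (z - v)⁻¹ + (-1) * (z - w)⁻¹) = 0 := by
    refine integral_eq_zero_of_hasDerivAt
      (G := fun z => Complex.log ((z - v) / (z - w)))
      ((continuousOn_inv_sub hv).add hw') fun z hz => ?_
    convert hasDerivAt_log_div (h z hz) using 1
    ring
  rw [integral_add (continuousOn_inv_sub hv) hw', integral_const_mul] at h0
  rw [index_eq, index_eq]
  linear_combination (2 * Real.pi * Complex.I)⁻¹ * h0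

/-- A cycle does not wind around a point that it does not separate from a fixed point `c`. -/
theorem index_eq_zero_of_segment {c w : ℂ} (h : ∀ z ∈ Γ.image, w ∉ segment ℝ c z) :
    Γ.index w = 0 := by
  have hw : w ∉ Γ.image := fun hw => h w hw (right_mem_segment ℝ c w)
  -- Here `w` plays the part of the point off the segment from `z` to `c`, so the logarithm is a
  -- primitive of `(z - w)⁻¹` in the variable `z`.
  rw [index_eq, integral_eq_zero_of_hasDerivAt (continuousOn_inv_sub hw)
    (G := fun z => Complex.log ((w - z) / (w - c))), mul_zero]
  intro z hz
  have hz' := h z hz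
  rw [segment_symm] at hz'
  have h1 : w - z ≠ 0 := fun h0 => hz' (by rw [sub_eq_zero.1 h0]; exact left_mem_segment ℝ _ _)
  have h2 : w - c ≠ 0 := fun h0 => hz' (by rw [sub_eq_zero.1 h0]; exact right_mem_segment ℝ _ _)
  have h3 : z - w ≠ 0 := fun h0 => h1 (by rw [← neg_sub, h0, neg_zero])
  have h4 : HasDerivAt (fun z => (w - z) / (w - c)) (-1 / (w - c)) z :=
    ((hasDerivAt_id z).const_sub w).div_const (w - c)
  convert h4.clog (div_mem_slitPlane hz') using 1
  rw [eq_div_iff (div_ne_zero h1 h2)]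
  field_simp
  ring

theorem index_eq_zero_of_norm_lt {R : ℝ} {w : ℂ} (h : ∀ z ∈ Γ.image, ‖z‖ ≤ R) (hw : R < ‖w‖) :
    Γ.index w = 0 := by
  refine index_eq_zero_of_segment (c := 0) fun z hz hm => ?_
  have h0 : ‖(0 : ℂ)‖ ≤ R := by simpa using (norm_nonneg z).trans (h z hz)
  have := (convex_closedBall (0 : ℂ) R).segment_subset (x := 0) (y := z) (by simpa using h0)
    (by simpa using h z hz) hm
  rw [mem_closedBall_zero_iff] at this
  linarith

/-- The points around which a cycle winds, together with the cycle, form a compact set. -/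
theorem isCompact_image_union_index_ne_zero (Γ : Cycle) :
    IsCompact (Γ.image ∪ {w | Γ.index w ≠ 0}) := by
  obtain ⟨R, hR⟩ := Γ.isCompact_image.isBounded.exists_norm_le
  refine Metric.isCompact_of_isClosed_isBounded ?_ ?_
  -- A small ball about a point off the cycle misses the cycle, and the index is constant along its
  -- radii.
  · rw [← isOpen_compl_iff, Metric.isOpen_iff]
    intro w hw
    simp only [Set.mem_compl_iff, Set.mem_union, Set.mem_ofPred_eq, not_or, not_not] at hw
    obtain ⟨ε, hε, hb⟩ := Metric.isOpen_iff.1 Γ.isCompact_image.isClosed.isOpen_compl w hw.1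
    refine ⟨ε, hε, fun v hv => ?_⟩
    simp only [Set.mem_compl_iff, Set.mem_union, Set.mem_ofPred_eq, not_or, not_not]
    refine ⟨hb hv, ?_⟩
    rw [← hw.2]
    refine index_eq_of_segment fun z hz hm => ?_
    exact hb ((convex_ball w ε).segment_subset hv (Metric.mem_ball_self hε) hm) hz
  · refine isBounded_iff_forall_norm_le.2 ⟨R, fun w hw => ?_⟩
    by_contra! h
    rcases hw with hw | hw
    · exact absurd (hR w hw) (not_le.2 h)
    · exact hw (index_eq_zero_of_norm_lt hR h)

/-- Cauchy's theorem in a disc. -/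
theorem integral_eq_zero_of_ball {F : ℂ → ℂ} {c : ℂ} {R : ℝ}
    (hF : DifferentiableOn ℂ F (Metric.ball c R)) (hΓ : Γ.image ⊆ Metric.ball c R) :
    Γ.integral F = 0 := by
  obtain ⟨G, hG⟩ := hF.isExactOn_ball
  exact integral_eq_zero_of_hasDerivAt (hF.continuousOn.mono hΓ) fun z hz => hG z (hΓ hz)

end Cycle

/-! ### Cycles made of grid edges -/

namespace Grid

/-- The corners of a unit square of the integer grid, relative to its lower left corner and in
counterclockwise order. -/
def corner : Fin 4 → ℤ × ℤ := ![(0, 0), (1, 0), (1, 1), (0, 1)]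

/-- The displacement from a square to its neighbour across the edge from `corner i` to
`corner (i + 1)`. -/
def dir : Fin 4 → ℤ × ℤ := ![(0, -1), (1, 0), (0, 1), (-1, 0)]

theorem corner_add_one (i : Fin 4) : corner (i + 1) = corner i + dir (i + 1) := by
  revert i; decide

theorem corner_add_three (i : Fin 4) : corner (i + 1) = corner (i + 3) + dir (i + 1) + dir i := by
  revert i; decide

theorem dir_add_two (i : Fin 4) : dir (i + 2) = -dir i := by
  revert i; decide

theorem dir_add_corner_add_two (i : Fin 4) : dir i + corner (i + 2) = corner (i + 1) := by
  revert i; decide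

theorem dir_add_corner_add_three (i : Fin 4) : dir i + corner (i + 2 + 1) = corner i := by
  revert i; decide

/-- The boundary edges of a finite set of squares; the edge `(Q, i)` is the edge `i` of `Q`. -/
def boundary (S : Finset (ℤ × ℤ)) : Finset ((ℤ × ℤ) × Fin 4) :=
  (S ×ˢ Finset.univ).filter fun e => e.1 + dir e.2 ∉ S

theorem mem_boundary {S : Finset (ℤ × ℤ)} {e : (ℤ × ℤ) × Fin 4} :
    e ∈ boundary S ↔ e.1 ∈ S ∧ e.1 + dir e.2 ∉ S := by
  simp [boundary]

/-- The boundary edge that follows a boundary edge. -/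
def step (S : Finset (ℤ × ℤ)) (e : (ℤ × ℤ) × Fin 4) : (ℤ × ℤ) × Fin 4 :=
  -- At the end corner the path turns left around the same square, goes straight on along the next
  -- square, or turns right around the diagonal one. Where two squares of `S` touch only at this
  -- corner, the first case keeps the path on its own square.
  if e.1 + dir (e.2 + 1) ∉ S then (e.1, e.2 + 1)
  else if e.1 + dir (e.2 + 1) + dir e.2 ∉ S then (e.1 + dir (e.2 + 1), e.2)
  else (e.1 + dir (e.2 + 1) + dir e.2, e.2 + 3)

/-- The boundary edge that precedes a boundary edge. -/
def back (S : Finset (ℤ × ℤ)) (e : (ℤ × ℤ) × Fin 4) : (ℤ × ℤ) × Fin 4 :=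
  if e.1 + dir (e.2 + 3) ∉ S then (e.1, e.2 + 3)
  else if e.1 + dir (e.2 + 3) + dir e.2 ∉ S then (e.1 + dir (e.2 + 3), e.2)
  else (e.1 + dir (e.2 + 3) + dir e.2, e.2 + 1)

theorem dir_add_three (i : Fin 4) : dir (i + 3) = -dir (i + 1) := by
  revert i; decide

theorem step_mem {S : Finset (ℤ × ℤ)} {e : (ℤ × ℤ) × Fin 4} (he : e ∈ boundary S) :
    step S e ∈ boundary S := by
  obtain ⟨Q, i⟩ := e
  rw [mem_boundary] at he ⊢
  obtain ⟨h1, h2⟩ := he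
  simp only at h1 h2
  unfold step
  split_ifs with h3 h4
  · refine ⟨h4, ?_⟩
    have : Q + dir (i + 1) + dir i + dir (i + 3) = Q + dir i := by rw [dir_add_three]; abel
    rwa [this]
  · exact ⟨h3, h4⟩
  · exact ⟨h1, h3⟩

/-- A left inverse suffices: it makes `step` injective, and an injective self-map of the finite set
of boundary edges is a permutation. -/
theorem back_step {S : Finset (ℤ × ℤ)} {e : (ℤ × ℤ) × Fin 4} (he : e ∈ boundary S) :
    back S (step S e) = e := by
  obtain ⟨Q, i⟩ := e
  rw [mem_boundary] at he
  obtain ⟨h1, h2⟩ := he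
  simp only at h1 h2
  have e1 : ∀ i : Fin 4, i + 1 + 3 = i := by decide
  have e2 : ∀ i : Fin 4, i + 3 + 3 = i + 2 := by decide
  have e3 : ∀ i : Fin 4, i + 3 + 1 = i := by decide
  unfold step
  split_ifs with h3 h4
  · have h5 : Q + dir (i + 1) + dir i + dir (i + 2) = Q + dir (i + 1) := by
      rw [dir_add_two]; abel
    have h6 : Q + dir (i + 1) + dir (i + 3) = Q := by rw [dir_add_three]; abel
    simp only at h3
    simp [back, e2, e3, h5, h6, h1, h3]
  · have : Q + dir (i + 1) + dir (i + 3) = Q := by rw [dir_add_three]; abel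
    simp [back, this, h1, h2]
  · simp [back, e1, h2]

theorem step_corner (S : Finset (ℤ × ℤ)) (e : (ℤ × ℤ) × Fin 4) :
    (step S e).1 + corner (step S e).2 = e.1 + corner (e.2 + 1) := by
  obtain ⟨Q, i⟩ := e
  unfold step
  split_ifs with h3 h4
  · simp only [corner_add_three i]; abel
  · simp only [corner_add_one]; abel
  · rfl

/-- The permutation of the boundary edges that leads from each edge to the following one. -/
def stepPerm (S : Finset (ℤ × ℤ)) : Equiv.Perm (boundary S) :=
  Equiv.ofBijective (fun e => ⟨step S e, step_mem e.2⟩) <| Finite.injective_iff_bijective.1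
    fun e e' h => Subtype.ext <| by
      rw [← back_step e.2, ← back_step e'.2]
      exact congrArg (back S) (Subtype.ext_iff.1 h)

/-- The point of the plane with grid coordinates `p` in the grid of width `δ`. -/
def point (δ : ℝ) (p : ℤ × ℤ) : ℂ := δ * (p.1 + p.2 * Complex.I)

/-- The parametrization of an edge. -/
def edge (δ : ℝ) (e : (ℤ × ℤ) × Fin 4) (t : ℝ) : ℂ :=
  point δ (e.1 + corner e.2) + t * (point δ (e.1 + corner (e.2 + 1)) - point δ (e.1 + corner e.2))

theorem edge_zero (δ : ℝ) (e : (ℤ × ℤ) × Fin 4) : edge δ e 0 = point δ (e.1 + corner e.2) := by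
  simp [edge]

theorem edge_one (δ : ℝ) (e : (ℤ × ℤ) × Fin 4) : edge δ e 1 = point δ (e.1 + corner (e.2 + 1)) := by
  simp [edge]

theorem contDiff_edge (δ : ℝ) (e : (ℤ × ℤ) × Fin 4) : ContDiff ℝ 1 (edge δ e) :=
  contDiff_const.add (Complex.ofRealCLM.contDiff.mul contDiff_const)

theorem deriv_edge (δ : ℝ) (e : (ℤ × ℤ) × Fin 4) (t : ℝ) :
    deriv (edge δ e) t = point δ (e.1 + corner (e.2 + 1)) - point δ (e.1 + corner e.2) := by
  have h : HasDerivAt (fun t : ℝ => (t : ℂ)) 1 t := Complex.ofRealCLM.hasDerivAt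
  exact ((h.mul_const _).const_add _).deriv.trans (one_mul _)

/-- The positively oriented boundary of a finite set of squares. -/
def cycle (δ : ℝ) (S : Finset (ℤ × ℤ)) : Cycle where
  n := (boundary S).card
  arc i := edge δ ((boundary S).equivFin.symm i)
  contDiff _ := contDiff_edge _ _
  next := ((boundary S).equivFin.permCongr) (stepPerm S)
  closed i := by
    rw [edge_one, edge_zero]
    simp only [Equiv.permCongr_apply, Equiv.symm_apply_apply]
    exact congrArg _ (step_corner S _).symm

/-- The positively oriented boundary of a square. -/
def square (δ : ℝ) (Q : ℤ × ℤ) : Cycle where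
  n := 4
  arc i := edge δ (Q, i)
  contDiff _ := contDiff_edge _ _
  next := Equiv.addRight 1
  closed i := by rw [edge_one, edge_zero]; rfl

/-- Edge `i + 2` of the neighbour across edge `i` is the same segment run backwards; substitute `1 -
t`. -/
theorem integral_reversed_edge (δ : ℝ) (F : ℂ → ℂ) (Q : ℤ × ℤ) (i : Fin 4) :
    (∫ t in (0 : ℝ)..1, deriv (edge δ (Q, i)) t * F (edge δ (Q, i) t)) +
      ∫ t in (0 : ℝ)..1, deriv (edge δ (Q + dir i, i + 2)) t * F (edge δ (Q + dir i, i + 2) t) =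
      0 := by
  have h1 : ∀ t : ℝ, edge δ (Q + dir i, i + 2) t = edge δ (Q, i) (1 - t) := fun t => by
    simp only [edge, add_assoc Q, dir_add_corner_add_two, dir_add_corner_add_three]
    push_cast
    ring
  simp only [deriv_edge, h1, add_assoc Q, dir_add_corner_add_two, dir_add_corner_add_three]
  rw [intervalIntegral.integral_comp_sub_left (fun t => (point δ (Q + corner i) -
    point δ (Q + corner (i + 1))) * F (edge δ (Q, i) t)) 1, sub_self, sub_zero,
    intervalIntegral.integral_const_mul, intervalIntegral.integral_const_mul]
  ring

theorem integral_square (δ : ℝ) (Q : ℤ × ℤ) (F : ℂ → ℂ) : (square δ Q).integral F =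
    ∑ i : Fin 4, ∫ t in (0 : ℝ)..1, deriv (edge δ (Q, i)) t * F (edge δ (Q, i) t) := rfl

/-- The integral along the boundary of a set of squares is the sum of the integrals along the
boundaries of the squares. -/
theorem integral_cycle (δ : ℝ) (S : Finset (ℤ × ℤ)) (F : ℂ → ℂ) :
    (cycle δ S).integral F = ∑ Q ∈ S, (square δ Q).integral F := by
  set g : (ℤ × ℤ) × Fin 4 → ℂ := fun e =>
    ∫ t in (0 : ℝ)..1, deriv (edge δ e) t * F (edge δ e t) with hg
  have h1 : (cycle δ S).integral F = ∑ e ∈ boundary S, g e := by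
    rw [← Finset.sum_coe_sort, ← Equiv.sum_comp (boundary S).equivFin.symm]
    rfl
  have h2 : ∑ Q ∈ S, (square δ Q).integral F = ∑ e ∈ S ×ˢ Finset.univ, g e := by
    rw [Finset.sum_product]
    rfl
  -- Among all edges of all squares, those with a square of `S` on both sides cancel in pairs under
  -- the involution that passes to the neighbour.
  rw [h1, h2, ← Finset.sum_filter_add_sum_filter_not (S ×ˢ Finset.univ) fun e => e.1 + dir e.2 ∉ S,
    Finset.sum_involution (s := (S ×ˢ Finset.univ).filter fun e => ¬ e.1 + dir e.2 ∉ S)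
      (fun e _ => (e.1 + dir e.2, e.2 + 2)), add_zero]
  · rfl
  · rintro ⟨Q, i⟩ -
    exact integral_reversed_edge δ F Q i
  · rintro ⟨Q, i⟩ - - h
    have : ∀ i : Fin 4, i + 2 ≠ i := by decide
    exact this i (Prod.ext_iff.1 h).2
  · rintro ⟨Q, i⟩ h
    simp only [Finset.mem_filter, Finset.mem_product, Finset.mem_univ, and_true, not_not,
      dir_add_two, add_neg_cancel_right] at h ⊢
    exact ⟨h.2, h.1⟩
  · rintro ⟨Q, i⟩ -
    have : ∀ i : Fin 4, i + 2 + 2 = i := by decide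
    simp [dir_add_two, this]

theorem index_cycle (δ : ℝ) (S : Finset (ℤ × ℤ)) (w : ℂ) :
    (cycle δ S).index w = ∑ Q ∈ S, (square δ Q).index w := by
  simp only [Cycle.index_eq, integral_cycle, Finset.mul_sum]

/-- The closed square with index `Q`. -/
def closedSquare (δ : ℝ) (Q : ℤ × ℤ) : Set ℂ :=
  Set.Icc (δ * Q.1) (δ * (Q.1 + 1)) ×ℂ Set.Icc (δ * Q.2) (δ * (Q.2 + 1))

/-- The center of the square with index `Q`. -/
def center (δ : ℝ) (Q : ℤ × ℤ) : ℂ := ⟨δ * (Q.1 + 1 / 2), δ * (Q.2 + 1 / 2)⟩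

theorem convex_closedSquare (δ : ℝ) (Q : ℤ × ℤ) : Convex ℝ (closedSquare δ Q) :=
  ((convex_Icc _ _).linear_preimage Complex.reLm).inter
    ((convex_Icc _ _).linear_preimage Complex.imLm)

theorem mem_closedSquare {δ : ℝ} {Q : ℤ × ℤ} {w : ℂ} : w ∈ closedSquare δ Q ↔
    (δ * Q.1 ≤ w.re ∧ w.re ≤ δ * (Q.1 + 1)) ∧ (δ * Q.2 ≤ w.im ∧ w.im ≤ δ * (Q.2 + 1)) :=
  Iff.rfl

theorem exists_mem_closedSquare {δ : ℝ} (hδ : 0 < δ) (w : ℂ) : ∃ Q, w ∈ closedSquare δ Q := by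
  have h : ∀ x : ℝ, δ * ⌊x / δ⌋ ≤ x ∧ x ≤ δ * (⌊x / δ⌋ + 1) := fun x => by
    have h1 := Int.floor_le (x / δ)
    have h2 := (Int.lt_floor_add_one (x / δ)).le
    rw [le_div_iff₀' hδ] at h1
    rw [div_le_iff₀' hδ] at h2
    exact ⟨h1, h2⟩
  exact ⟨(⌊w.re / δ⌋, ⌊w.im / δ⌋), h _, h _⟩

theorem center_mem_closedSquare {δ : ℝ} (hδ : 0 < δ) (Q : ℤ × ℤ) :
    center δ Q ∈ closedSquare δ Q := by
  simp only [mem_closedSquare, center]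
  refine ⟨⟨?_, ?_⟩, ?_, ?_⟩ <;> gcongr <;> norm_num

theorem eq_of_center_mem_closedSquare {δ : ℝ} (hδ : 0 < δ) {Q R : ℤ × ℤ}
    (h : center δ Q ∈ closedSquare δ R) : Q = R := by
  have key : ∀ a b : ℤ, δ * b ≤ δ * (a + 1 / 2) → δ * (a + 1 / 2) ≤ δ * (b + 1) → a = b := by
    intro a b h1 h2
    have h1 := le_of_mul_le_mul_left h1 hδ
    have h2 := le_of_mul_le_mul_left h2 hδ
    have h3 : (b : ℝ) < (a + 1 : ℤ) := by push_cast; linarith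
    have h4 : (a : ℝ) < (b + 1 : ℤ) := by push_cast; linarith
    have h3 := Int.cast_lt.1 h3
    have h4 := Int.cast_lt.1 h4
    omega
  exact Prod.ext (key _ _ h.1.1 h.1.2) (key _ _ h.2.1 h.2.2)

theorem norm_sub_lt {δ : ℝ} (hδ : 0 < δ) {Q : ℤ × ℤ} {v w : ℂ} (hv : v ∈ closedSquare δ Q)
    (hw : w ∈ closedSquare δ Q) : ‖v - w‖ < 3 * δ := by
  rw [mem_closedSquare] at hv hw
  have h1 : |(v - w).re| ≤ δ := by rw [Complex.sub_re, abs_le]; constructor <;> linarith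
  have h2 : |(v - w).im| ≤ δ := by rw [Complex.sub_im, abs_le]; constructor <;> linarith
  have := Complex.norm_le_abs_re_add_abs_im (v - w)
  linarith

theorem edge_mem_closedSquare {δ : ℝ} (hδ : 0 < δ) (e : (ℤ × ℤ) × Fin 4) {t : ℝ}
    (ht : t ∈ Set.Icc (0 : ℝ) 1) :
    edge δ e t ∈ closedSquare δ e.1 ∧ edge δ e t ∈ closedSquare δ (e.1 + dir e.2) := by
  obtain ⟨⟨a, b⟩, i⟩ := e
  obtain ⟨h0, h1⟩ := ht
  have h2 : t * δ ≤ δ := by nlinarith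
  have h3 : 0 ≤ t * δ := by positivity
  fin_cases i <;> simp [mem_closedSquare, edge, point, corner, dir] <;> grind

/-- Points of edges have a coordinate that is an integer multiple of the grid width. -/
theorem edge_not_interior {δ : ℝ} (hδ : 0 < δ) (e : (ℤ × ℤ) × Fin 4) (t : ℝ) {Q : ℤ × ℤ}
    (h1 : δ * Q.1 < (edge δ e t).re) (h2 : (edge δ e t).re < δ * (Q.1 + 1))
    (h3 : δ * Q.2 < (edge δ e t).im) (h4 : (edge δ e t).im < δ * (Q.2 + 1)) : False := by
  have key : ∀ a b : ℤ, δ * a < δ * b → δ * b < δ * (a + 1) → False := by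
    intro a b h1 h2
    have h1 := lt_of_mul_lt_mul_left h1 hδ.le
    have h2 := lt_of_mul_lt_mul_left h2 hδ.le
    have h2 : (b : ℝ) < (a + 1 : ℤ) := by push_cast; exact h2
    have h1 := Int.cast_lt.1 h1
    have h2 := Int.cast_lt.1 h2
    omega
  obtain ⟨⟨a, b⟩, i⟩ := e
  obtain ⟨c, d⟩ := Q
  fin_cases i <;> simp [edge, point, corner] at h1 h2 h3 h4
  · exact key d b (by linarith) (by linarith)
  · exact key c (a + 1) (by push_cast; linarith) (by push_cast; linarith)
  · exact key d (b + 1) (by push_cast; linarith) (by push_cast; linarith)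
  · exact key c a (by linarith) (by linarith)

theorem image_square_subset {δ : ℝ} (hδ : 0 < δ) (Q : ℤ × ℤ) :
    (square δ Q).image ⊆ closedSquare δ Q := by
  intro z hz
  obtain ⟨i, t, ht, rfl⟩ := Set.mem_iUnion.1 hz
  exact (edge_mem_closedSquare hδ (Q, i) ht).1

/-- By convexity the segments from the centre to the boundary stay in the square, so none of them
contains `w`. -/
theorem index_square_eq_zero {δ : ℝ} (hδ : 0 < δ) {Q : ℤ × ℤ} {w : ℂ} (hw : w ∉ closedSquare δ Q) :
    (square δ Q).index w = 0 :=
  Cycle.index_eq_zero_of_segment (c := center δ Q) fun _ hz h => hw <|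
    (convex_closedSquare δ Q).segment_subset (center_mem_closedSquare hδ Q)
      (image_square_subset hδ Q hz) h

/-- One side of the unit square is a quarter turn seen from the centre. The values stay in the open
lower half-plane, where the principal logarithm is a primitive, and the end value is `I` times the
start value. -/
theorem integral_inv_edge : ∫ t in (0 : ℝ)..1, ((t : ℂ) - (1 / 2 + Complex.I / 2))⁻¹ =
    Real.pi * Complex.I / 2 := by
  have hs : ∀ t : ℝ, (t : ℂ) - (1 / 2 + Complex.I / 2) ∈ Complex.slitPlane := fun t =>
    Or.inr (by simp)
  have h1 : ∀ t : ℝ, HasDerivAt (fun t : ℝ => Complex.log ((t : ℂ) - (1 / 2 + Complex.I / 2)))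
      (((t : ℂ) - (1 / 2 + Complex.I / 2))⁻¹) t := fun t => by
    have h : HasDerivAt (fun t : ℝ => (t : ℂ) - (1 / 2 + Complex.I / 2)) 1 t :=
      (Complex.ofRealCLM.hasDerivAt (x := t)).sub_const _
    simpa using h.clog_real (hs t)
  rw [intervalIntegral.integral_eq_sub_of_hasDerivAt (fun t _ => h1 t)]
  · have h2 : ((1 : ℝ) : ℂ) - (1 / 2 + Complex.I / 2) =
        (((0 : ℝ) : ℂ) - (1 / 2 + Complex.I / 2)) * Complex.I := by
      push_cast
      linear_combination (1 / 2 : ℂ) * Complex.I_mul_I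
    rw [h2, Complex.log_mul (Complex.slitPlane_ne_zero (hs 0)) Complex.I_ne_zero, Complex.log_I]
    · ring
    · have h3 : (((0 : ℝ) : ℂ) - (1 / 2 + Complex.I / 2)).arg < 0 := by
        rw [Complex.arg_neg_iff]; simp
      have h4 := Complex.neg_pi_lt_arg (((0 : ℝ) : ℂ) - (1 / 2 + Complex.I / 2))
      rw [Complex.arg_I]
      constructor <;> linarith [Real.pi_pos]
  · refine Continuous.intervalIntegrable ?_ _ _
    exact (Complex.continuous_ofReal.sub continuous_const).inv₀ fun t =>
      Complex.slitPlane_ne_zero (hs t)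

/-- Seen from the centre, the four sides are the side of `integral_inv_edge` multiplied by `δ * I ^
i`. This factor cancels between the derivative and the reciprocal. -/
theorem index_square_center {δ : ℝ} (hδ : 0 < δ) (Q : ℤ × ℤ) :
    (square δ Q).index (center δ Q) = 1 := by
  have hδ' : (δ : ℂ) ≠ 0 := by exact_mod_cast hδ.ne'
  have h : ∀ i : Fin 4, ∫ t in (0 : ℝ)..1, deriv (edge δ (Q, i)) t *
      (edge δ (Q, i) t - center δ Q)⁻¹ = Real.pi * Complex.I / 2 := fun i => by
    rw [← integral_inv_edge]
    refine intervalIntegral.integral_congr fun t _ => ?_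
    have hs : (t : ℂ) - (1 / 2 + Complex.I / 2) ≠ 0 := fun h => by
      simpa using congrArg Complex.im h
    have hc : edge δ (Q, i) t - center δ Q = δ * (Complex.I ^ (i : ℕ) *
        ((t : ℂ) - (1 / 2 + Complex.I / 2))) := by
      fin_cases i <;> apply Complex.ext <;>
        simp [edge, point, corner, center, pow_succ] <;> ring
    have hd : deriv (edge δ (Q, i)) t = δ * Complex.I ^ (i : ℕ) := by
      rw [deriv_edge]
      fin_cases i <;> apply Complex.ext <;>
        simp [point, corner, pow_succ] <;> ring
    simp only [hc, hd]
    have hI : Complex.I ^ (i : ℕ) ≠ 0 := pow_ne_zero _ Complex.I_ne_zero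
    field_simp
  rw [Cycle.index_eq, integral_square]
  simp only [h, Finset.sum_const, Finset.card_univ, Fintype.card_fin]
  have := Complex.two_pi_I_ne_zero
  have hpi : (Real.pi : ℂ) ≠ 0 := by exact_mod_cast Real.pi_ne_zero
  have hI := Complex.I_ne_zero
  rw [nsmul_eq_mul]
  field_simp
  norm_num

theorem index_square_center_of_ne {δ : ℝ} (hδ : 0 < δ) {Q R : ℤ × ℤ} (h : R ≠ Q) :
    (square δ R).index (center δ Q) = 0 :=
  index_square_eq_zero hδ fun hm => h (eq_of_center_mem_closedSquare hδ hm).symm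

/-- The squares that meet a bounded set. -/
theorem finite_squares {δ : ℝ} (hδ : 0 < δ) {K : Set ℂ} (hK : Bornology.IsBounded K) :
    {Q : ℤ × ℤ | (closedSquare δ Q ∩ K).Nonempty}.Finite := by
  obtain ⟨R, hR⟩ := hK.exists_norm_le
  obtain ⟨M, hM⟩ := exists_nat_gt (R / δ + 1)
  refine (Set.finite_Icc ((-M, -M) : ℤ × ℤ) (M, M)).subset ?_
  rintro ⟨a, b⟩ ⟨w, hw, hwK⟩
  have key : ∀ (x : ℝ) (a : ℤ), |x| ≤ R → δ * a ≤ x → x ≤ δ * (a + 1) → -(M : ℤ) ≤ a ∧ a ≤ M := by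
    intro x a h h1 h2
    rw [abs_le] at h
    have h3 : (a : ℝ) ≤ R / δ := by rw [le_div_iff₀' hδ]; linarith
    have h4 : -(R / δ) ≤ a + 1 := by rw [← neg_div, div_le_iff₀' hδ]; linarith
    constructor
    · have : ((-(M : ℤ) : ℤ) : ℝ) ≤ a := by push_cast; linarith
      exact_mod_cast this
    · have : (a : ℝ) ≤ ((M : ℤ) : ℝ) := by push_cast; linarith
      exact_mod_cast this
  have h1 := key _ _ ((Complex.abs_re_le_norm w).trans (hR w hwK)) hw.1.1 hw.1.2
  have h2 := key _ _ ((Complex.abs_im_le_norm w).trans (hR w hwK)) hw.2.1 hw.2.2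
  exact ⟨⟨h1.1, h2.1⟩, h1.2, h2.2⟩

/-- Used for both coordinates of a segment from a point of a closed square to its centre: all points
except possibly the first are interior to the square. -/
theorem lt_of_mem_openSegment {a b x y z : ℝ} (h1 : a < y) (h2 : y < b) (h3 : a ≤ x) (h4 : x ≤ b)
    {s t : ℝ} (hs : 0 ≤ s) (ht : 0 < t) (hst : s + t = 1) (hz : s * x + t * y = z) :
    a < z ∧ z < b := by
  obtain rfl : s = 1 - t := by linarith
  subst hz
  constructor <;> nlinarith

/-- A compact subset of an open set is surrounded by a cycle, along which Cauchy's theorem holds. -/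
theorem exists_cycle {K U : Set ℂ} (hK : IsCompact K) (hU : IsOpen U) (hKU : K ⊆ U) :
    ∃ Γ : Cycle, Γ.Surrounds K U ∧
      ∀ F : ℂ → ℂ, DifferentiableOn ℂ F U → Γ.integral F = 0 := by
  obtain ⟨ε, hε, hεU⟩ := hK.exists_thickening_subset_open hU hKU
  -- A square that meets `K` lies in the ball of radius `3 * δ` about its centre, and this whole
  -- ball is within `6 * δ` of `K`.
  obtain ⟨δ, hδ, rfl⟩ : ∃ δ : ℝ, 0 < δ ∧ 6 * δ = ε := ⟨ε / 6, by positivity, by ring⟩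
  set S := (finite_squares hδ hK.isBounded).toFinset with hS
  have memS : ∀ Q, Q ∈ S ↔ (closedSquare δ Q ∩ K).Nonempty := fun Q => by simp [hS]
  have hball : ∀ Q ∈ S, Metric.ball (center δ Q) (3 * δ) ⊆ U := by
    intro Q hQ v hv
    obtain ⟨w, hw, hwK⟩ := (memS Q).1 hQ
    refine hεU (Metric.mem_thickening_iff.2 ⟨w, hwK, ?_⟩)
    have h1 := norm_sub_lt hδ (center_mem_closedSquare hδ Q) hw
    rw [← dist_eq_norm] at h1
    have := dist_triangle v (center δ Q) w
    rw [Metric.mem_ball] at hv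
    linarith
  have hsub : ∀ Q, closedSquare δ Q ⊆ Metric.ball (center δ Q) (3 * δ) := fun Q v hv => by
    rw [mem_ball_iff_norm]
    exact norm_sub_lt hδ hv (center_mem_closedSquare hδ Q)
  have himage : ∀ (i : Fin (cycle δ S).n) (t : ℝ), ∃ e ∈ boundary S,
      (cycle δ S).arc i t = edge δ e t := fun i t =>
    ⟨(boundary S).equivFin.symm i, Subtype.coe_prop _, rfl⟩
  have hmem : ∀ i, ∀ t ∈ Set.Icc (0 : ℝ) 1, (cycle δ S).arc i t ∈ U \ K := by
    intro i t ht
    obtain ⟨e, he, h⟩ := himage i t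
    rw [h]
    rw [mem_boundary] at he
    -- A boundary edge also lies on the square across it, which is not in `S` and therefore misses
    -- `K`.
    have h1 := edge_mem_closedSquare hδ e ht
    exact ⟨hball _ he.1 (hsub _ h1.1), fun hm => he.2 ((memS _).2 ⟨_, h1.2, hm⟩)⟩
  refine ⟨cycle δ S, ⟨hmem, fun w hw => ?_, fun w hw => ?_⟩, fun F hF => ?_⟩
  · obtain ⟨Q, hQ⟩ := exists_mem_closedSquare hδ w
    -- The index is computed at the centre of a square containing `w`. The connecting segment misses
    -- the cycle: its points other than `w` are interior to the square, where there are no edges,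
    -- and `w` itself is in `K`.
    rw [Cycle.index_eq_of_segment (w := center δ Q), index_cycle,
      Finset.sum_eq_single_of_mem Q ((memS Q).2 ⟨w, hQ, hw⟩)
        fun R _ hR => index_square_center_of_ne hδ hR, index_square_center hδ]
    intro z hz hseg
    obtain ⟨i, t, ht, rfl⟩ := Set.mem_iUnion.1 hz
    have hzK := (hmem i t ht).2
    obtain ⟨e, he, h⟩ := himage i t
    obtain ⟨s, s', hs, hs', hss, hz⟩ := hseg
    rcases hs'.eq_or_lt with h0 | h0
    · apply hzK
      rw [← h0, add_zero] at hss
      rw [← h0, hss, one_smul, zero_smul, add_zero] at hz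
      rwa [← hz]
    · rw [h] at hz
      have hre := congrArg Complex.re hz
      have him := congrArg Complex.im hz
      simp only [Complex.add_re, Complex.add_im, Complex.real_smul, Complex.re_ofReal_mul,
        Complex.im_ofReal_mul, center] at hre him
      have h1 := lt_of_mem_openSegment (by linarith) (by linarith) hQ.1.1 hQ.1.2 hs h0 hss hre
      have h2 := lt_of_mem_openSegment (by linarith) (by linarith) hQ.2.1 hQ.2.2 hs h0 hss him
      exact edge_not_interior hδ e t h1.1 h1.2 h2.1 h2.2
  · rw [index_cycle]
    exact Finset.sum_eq_zero fun Q hQ => index_square_eq_zero hδ fun h => hw (hball Q hQ (hsub Q h))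
  · rw [integral_cycle]
    exact Finset.sum_eq_zero fun Q hQ => Cycle.integral_eq_zero_of_ball (hF.mono (hball Q hQ))
      ((image_square_subset hδ Q).trans (hsub Q))

end Grid

/-! ### The homological form of Cauchy's theorem -/

namespace Cycle

variable {Γ : Cycle}

theorem integral_add_const_mul {F G : ℂ → ℂ} (hF : ContinuousOn F Γ.image)
    (hG : ContinuousOn G Γ.image) (c : ℂ) :
    Γ.integral (fun z => F z + c * G z) = Γ.integral F + c * Γ.integral G := by
  have hG' : ContinuousOn (fun z => c * G z) Γ.image := continuousOn_const.mul hG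
  rw [integral_add hF hG', integral_const_mul]

theorem integral_eq_zero_of_forall {F : ℂ → ℂ} (h : ∀ z ∈ Γ.image, F z = 0) :
    Γ.integral F = 0 := by
  rw [integral_congr (G := fun _ => 0 * 0) fun z hz => by simp [h z hz], integral_const_mul,
    zero_mul]

/-- Fubini's theorem for two cycles. -/
theorem integral_integral_swap (Γ Δ : Cycle) {G : ℂ → ℂ → ℂ}
    (hG : ContinuousOn (Function.uncurry G) (Γ.image ×ˢ Δ.image)) :
    Γ.integral (fun z => Δ.integral fun w => G z w) =
      Δ.integral fun w => Γ.integral fun z => G z w := by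
  set g : Fin Γ.n → Fin Δ.n → ℝ → ℝ → ℂ := fun i k t s =>
    deriv (Γ.arc i) t * (deriv (Δ.arc k) s * G (Γ.arc i t) (Δ.arc k s)) with hg
  have hint : ∀ i k, MeasureTheory.IntegrableOn (Function.uncurry (g i k))
      (Set.Ioc (0 : ℝ) 1 ×ˢ Set.Ioc (0 : ℝ) 1) := fun i k => by
    refine (ContinuousOn.integrableOn_compact (K := Set.Icc 0 1 ×ˢ Set.Icc 0 1)
      (isCompact_Icc.prod isCompact_Icc) ?_).mono_set
        (Set.prod_mono Set.Ioc_subset_Icc_self Set.Ioc_subset_Icc_self)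
    refine ((Γ.continuous_deriv_arc i).comp continuous_fst).continuousOn.mul
      (((Δ.continuous_deriv_arc k).comp continuous_snd).continuousOn.mul ?_)
    exact hG.comp (((Γ.contDiff i).continuous.comp continuous_fst).prodMk
      ((Δ.contDiff k).continuous.comp continuous_snd)).continuousOn
      fun p hp => ⟨arc_mem_image i hp.1, arc_mem_image k hp.2⟩
  have hint' : ∀ i k, MeasureTheory.Integrable (Function.uncurry (g i k))
      ((MeasureTheory.volume.restrict (Set.Ioc (0 : ℝ) 1)).prod
        (MeasureTheory.volume.restrict (Set.Ioc (0 : ℝ) 1))) := fun i k => by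
    rw [MeasureTheory.Measure.prod_restrict, ← MeasureTheory.Measure.volume_eq_prod]
    exact hint i k
  have h1 : Γ.integral (fun z => Δ.integral fun w => G z w) =
      ∑ i, ∑ k, ∫ t in (0 : ℝ)..1, ∫ s in (0 : ℝ)..1, g i k t s := by
    refine Finset.sum_congr rfl fun i _ => ?_
    rw [← intervalIntegral.integral_finsetSum]
    · refine intervalIntegral.integral_congr fun t _ => ?_
      simp only [integral, Finset.mul_sum, hg]
      simp only [intervalIntegral.integral_const_mul]
    · intro k _
      simp only [intervalIntegrable_iff, Set.uIoc_of_le zero_le_one,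
        intervalIntegral.integral_of_le zero_le_one]
      exact (hint' i k).integral_prod_left
  have h2 : Δ.integral (fun w => Γ.integral fun z => G z w) =
      ∑ k, ∑ i, ∫ s in (0 : ℝ)..1, ∫ t in (0 : ℝ)..1, g i k t s := by
    refine Finset.sum_congr rfl fun k _ => ?_
    rw [← intervalIntegral.integral_finsetSum]
    · refine intervalIntegral.integral_congr fun s _ => ?_
      simp only [integral, Finset.mul_sum, hg]
      refine Finset.sum_congr rfl fun i _ => ?_
      rw [← intervalIntegral.integral_const_mul]
      exact intervalIntegral.integral_congr fun t _ => by ring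
    · intro i _
      simp only [intervalIntegrable_iff, Set.uIoc_of_le zero_le_one,
        intervalIntegral.integral_of_le zero_le_one]
      exact (hint' i k).integral_prod_right
  rw [h1, h2, Finset.sum_comm]
  refine Finset.sum_congr rfl fun k _ => Finset.sum_congr rfl fun i _ =>
    MeasureTheory.intervalIntegral_intervalIntegral_swap ?_
  rw [Set.uIoc_of_le zero_le_one]
  exact hint i k

/-- Cauchy's integral formula, for cycles for which Cauchy's theorem holds. -/
theorem integral_mul_inv_sub {U : Set ℂ} (hU : IsOpen U) (hΓU : Γ.image ⊆ U)
    (hΓ : ∀ F : ℂ → ℂ, DifferentiableOn ℂ F U → Γ.integral F = 0) {F : ℂ → ℂ}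
    (hF : DifferentiableOn ℂ F U) {w : ℂ} (hw : w ∈ U) (hwΓ : w ∉ Γ.image) :
    Γ.integral (fun z => F z * (z - w)⁻¹) = 2 * Real.pi * Complex.I * Γ.index w * F w := by
  have hd : DifferentiableOn ℂ (dslope F w) U :=
    (Complex.differentiableOn_dslope (hU.mem_nhds hw)).2 hF
  -- Splitting off the holomorphic difference quotient leaves a multiple of the index integral.
  have h1 : Set.EqOn (fun z => F z * (z - w)⁻¹)
      (fun z => dslope F w z + F w * (z - w)⁻¹) Γ.image := fun z hz => by
    have hzw : z ≠ w := fun h => hwΓ (h ▸ hz)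
    simp only [dslope_of_ne F hzw, slope_def_field]
    ring
  rw [integral_congr h1, integral_add_const_mul (hd.continuousOn.mono hΓU)
    (continuousOn_inv_sub hwΓ), hΓ _ hd, integral_inv_sub]
  ring

/-- Cauchy's theorem: the integral of a holomorphic function along a cycle that does not wind
around any point outside the domain of the function is zero. -/
theorem integral_eq_zero_of_index_eq_zero {U : Set ℂ} (hU : IsOpen U) (hΓU : Γ.image ⊆ U)
    (hind : ∀ w ∉ U, Γ.index w = 0) {F : ℂ → ℂ} (hF : DifferentiableOn ℂ F U) :
    Γ.integral F = 0 := by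
  have hKU : Γ.image ∪ {w | Γ.index w ≠ 0} ⊆ U := Set.union_subset hΓU fun w hw => by
    by_contra h
    exact hw (hind w h)
  -- On `Γ`, `F` is its Cauchy integral over `Δ`. After the exchange, the inner integral is a
  -- multiple of the index of `Γ` about a point of `Δ`, which is zero because `Δ` avoids every point
  -- that `Γ` winds around.
  obtain ⟨Δ, hΔ, hΔ0⟩ := Grid.exists_cycle Γ.isCompact_image_union_index_ne_zero hU hKU
  have hΔ1 : ∀ z ∈ Δ.image, z ∈ U \ (Γ.image ∪ {w | Γ.index w ≠ 0}) := fun z hz => by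
    obtain ⟨i, t, ht, rfl⟩ := Set.mem_iUnion.1 hz
    exact hΔ.mem i t ht
  have hne : ∀ z ∈ Γ.image, ∀ w ∈ Δ.image, w - z ≠ 0 := fun z hz w hw h =>
    (hΔ1 w hw).2 (Or.inl (sub_eq_zero.1 h ▸ hz))
  have h1 : Set.EqOn (fun z => 2 * Real.pi * Complex.I * F z)
      (fun z => Δ.integral fun w => F w * (w - z)⁻¹) Γ.image := fun z hz => by
    have hzK : z ∈ Γ.image ∪ {w | Γ.index w ≠ 0} := Or.inl hz
    simp only
    rw [integral_mul_inv_sub hU (fun w hw => (hΔ1 w hw).1) hΔ0 hF (hKU hzK)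
      (fun h => (hΔ1 z h).2 hzK), hΔ.index_eq_one z hzK, mul_one]
  have h2 := integral_congr h1
  rw [integral_const_mul, integral_integral_swap, integral_eq_zero_of_forall (Γ := Δ)] at h2
  · exact (mul_eq_zero.1 h2).resolve_left Complex.two_pi_I_ne_zero
  · intro w hw
    have hwK := (hΔ1 w hw).2
    simp only [Set.mem_union, Set.mem_ofPred_eq, not_or, not_not] at hwK
    have h3 : Set.EqOn (fun z => F w * (w - z)⁻¹) (fun z => -F w * (z - w)⁻¹) Γ.image :=
      fun z _ => by simp only [← neg_sub z w, inv_neg]; ring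
    rw [integral_congr h3, integral_const_mul, integral_inv_sub, hwK.2]
    ring
  · refine ((hF.continuousOn.comp continuousOn_snd fun p hp => (hΔ1 _ hp.2).1)).mul ?_
    exact (continuousOn_snd.sub continuousOn_fst).inv₀ fun p hp => hne _ hp.1 _ hp.2

/-- Poles of order at least two have a single-valued primitive, whatever the winding number. -/
theorem integral_inv_sub_pow (Γ : Cycle) {w : ℂ} (hw : w ∉ Γ.image) (n : ℕ) :
    Γ.integral (fun z => (z - w)⁻¹ ^ (n + 2)) = 0 := by
  refine integral_eq_zero_of_hasDerivAt (G := fun z => -((n : ℂ) + 1)⁻¹ * (z - w)⁻¹ ^ (n + 1))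
    ((continuousOn_inv_sub hw).pow _) fun z hz => ?_
  have h0 : z - w ≠ 0 := fun h => hw (sub_eq_zero.1 h ▸ hz)
  have h1 : HasDerivAt (fun z : ℂ => (z - w)⁻¹) (-1 / (z - w) ^ 2) z :=
    ((hasDerivAt_id z).sub_const w).inv h0
  have hn : (n : ℂ) + 1 ≠ 0 := Nat.cast_add_one_ne_zero n
  have h2 : HasDerivAt (fun z : ℂ => (z - w)⁻¹ ^ (n + 1))
      (((n + 1 : ℕ) : ℂ) * (z - w)⁻¹ ^ n * (-1 / (z - w) ^ 2)) z := h1.pow (n + 1)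
  refine (h2.const_mul (-((n : ℂ) + 1)⁻¹)).congr_deriv ?_
  push_cast
  simp only [inv_pow]
  field_simp
  ring

/-- The power series of the difference quotient is that of `F` shifted by one place; compare
coefficients. -/
theorem iteratedDeriv_dslope {F : ℂ → ℂ} {w : ℂ} (hF : AnalyticAt ℂ F w) (n : ℕ) :
    iteratedDeriv n (dslope F w) w / n ! = iteratedDeriv (n + 1) F w / (n + 1)! := by
  have h1 := hF.hasFPowerSeriesAt.has_fpower_series_dslope_fslope
  have h2 := h1.analyticAt.hasFPowerSeriesAt
  have h3 := congrArg (fun p => p.coeff n) (h2.eq_formalMultilinearSeries h1)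
  simpa using h3

/-- Cauchy's integral formula for the derivatives. -/
theorem integral_mul_inv_sub_pow {U : Set ℂ} (hU : IsOpen U) (hΓU : Γ.image ⊆ U)
    (hind : ∀ w ∉ U, Γ.index w = 0) {w : ℂ} (hw : w ∈ U) (hwΓ : w ∉ Γ.image) (n : ℕ) :
    ∀ {F : ℂ → ℂ}, DifferentiableOn ℂ F U → Γ.integral (fun z => F z * (z - w)⁻¹ ^ (n + 1)) =
      2 * Real.pi * Complex.I * Γ.index w * (iteratedDeriv n F w / n !) := by
  induction n with
  | zero =>
    intro F hF
    simpa using integral_mul_inv_sub hU hΓU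
      (fun F hF => integral_eq_zero_of_index_eq_zero hU hΓU hind hF) hF hw hwΓ
  | succ n ih =>
    intro F hF
    have hd : DifferentiableOn ℂ (dslope F w) U :=
      (Complex.differentiableOn_dslope (hU.mem_nhds hw)).2 hF
    -- Subtracting `F w` lowers the order of the pole by one. The constant's own term has order at
    -- least two and integrates to zero.
    have h1 : Set.EqOn (fun z => F z * (z - w)⁻¹ ^ (n + 1 + 1))
        (fun z => dslope F w z * (z - w)⁻¹ ^ (n + 1) + F w * (z - w)⁻¹ ^ (n + 2)) Γ.image :=
      fun z hz => by
        have hzw : z ≠ w := fun h => hwΓ (h ▸ hz)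
        simp only [dslope_of_ne F hzw, slope_def_field]
        ring
    have hc := continuousOn_inv_sub hwΓ
    have hcp : ∀ m : ℕ, ContinuousOn (fun z => (z - w)⁻¹ ^ m) Γ.image := fun m => hc.pow m
    have hdc : ContinuousOn (fun z => dslope F w z * (z - w)⁻¹ ^ (n + 1)) Γ.image :=
      (hd.continuousOn.mono hΓU).mul (hcp _)
    rw [integral_congr h1, integral_add_const_mul hdc (hcp _), ih hd, integral_inv_sub_pow Γ hwΓ,
      iteratedDeriv_dslope (hF.analyticAt (hU.mem_nhds hw))]
    ring

end Cycle

/-! ### Mixed partial derivatives and multiple Cauchy integrals -/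

section Slices

variable {r : ℕ}

theorem partialDeriv_succ_cons (j : Fin r) (f : (Fin (r + 1) → ℂ) → ℂ) (a : ℂ) :
    (fun z => partialDeriv j.succ f (Fin.cons a z)) =
      partialDeriv j fun z => f (Fin.cons a z) := by
  funext z
  simp only [partialDeriv, Fin.cons_succ, ← Fin.cons_update]

theorem partialDeriv_zero_cons (f : (Fin (r + 1) → ℂ) → ℂ) (z : Fin r → ℂ) :
    (fun a => partialDeriv 0 f (Fin.cons a z)) = deriv fun a => f (Fin.cons a z) := by
  funext a
  simp only [partialDeriv, Fin.cons_zero, Fin.update_cons_zero]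

theorem iterate_partialDeriv_succ_cons (j : Fin r) (n : ℕ) (f : (Fin (r + 1) → ℂ) → ℂ) (a : ℂ) :
    (fun z => (partialDeriv j.succ)^[n] f (Fin.cons a z)) =
      (partialDeriv j)^[n] fun z => f (Fin.cons a z) :=
  Function.Semiconj.iterate_right (f := fun (f : (Fin (r + 1) → ℂ) → ℂ) z => f (Fin.cons a z))
    (fun f => partialDeriv_succ_cons j f a) n f

theorem iterate_partialDeriv_zero_cons (n : ℕ) (f : (Fin (r + 1) → ℂ) → ℂ) (z : Fin r → ℂ) :
    (fun a => (partialDeriv 0)^[n] f (Fin.cons a z)) =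
      iteratedDeriv n fun a => f (Fin.cons a z) := by
  rw [iteratedDeriv_eq_iterate]
  exact Function.Semiconj.iterate_right
    (f := fun (f : (Fin (r + 1) → ℂ) → ℂ) a => f (Fin.cons a z))
    (fun f => partialDeriv_zero_cons f z) n f

/-- The mixed partial derivative in all variables but the first one. -/
def tailPartial (α : Fin (r + 1) → ℕ) (f : (Fin (r + 1) → ℂ) → ℂ) : (Fin (r + 1) → ℂ) → ℂ :=
  (List.finRange r).foldr (fun j g => (partialDeriv j.succ)^[α j.succ] g) f

/-- `List.finRange` lists `0` first and `foldr` applies the head last, so the derivative in the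
first variable is outermost, matching the outermost integral in `contourIntegral_succ`. -/
theorem mixedPartial_succ (α : Fin (r + 1) → ℕ) (f : (Fin (r + 1) → ℂ) → ℂ) :
    mixedPartial α f = (partialDeriv 0)^[α 0] (tailPartial α f) := by
  rw [mixedPartial, List.finRange_succ, List.foldr_cons, List.foldr_map, tailPartial]

theorem tailPartial_cons (α : Fin (r + 1) → ℕ) (f : (Fin (r + 1) → ℂ) → ℂ) (a : ℂ) :
    (fun z => tailPartial α f (Fin.cons a z)) =
      mixedPartial (fun j => α j.succ) fun z => f (Fin.cons a z) := by
  unfold tailPartial mixedPartial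
  induction List.finRange r with
  | nil => rfl
  | cons j l ih =>
    rw [List.foldr_cons, List.foldr_cons, ← ih, ← iterate_partialDeriv_succ_cons]

/-- On `Ω` the partial derivative is `fderiv` evaluated at a basis vector. -/
theorem analyticOnNhd_partialDeriv (j : Fin r) {f : (Fin r → ℂ) → ℂ} {Ω : Set (Fin r → ℂ)}
    (hΩ : IsOpen Ω) (hf : AnalyticOnNhd ℂ f Ω) : AnalyticOnNhd ℂ (partialDeriv j f) Ω := by
  have h : AnalyticOnNhd ℂ (fun z => fderiv ℂ f z (Pi.single j 1)) Ω := fun z hz =>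
    ((ContinuousLinearMap.apply ℂ ℂ (Pi.single j (1 : ℂ) : Fin r → ℂ)).analyticAt
      (fderiv ℂ f z)).fun_comp (hf.fderiv z hz)
  refine h.congr hΩ fun z hz => ?_
  have h1 : HasFDerivAt f (fderiv ℂ f z) (Function.update z j (z j)) := by
    rw [Function.update_eq_self]
    exact (hf z hz).differentiableAt.hasFDerivAt
  exact (h1.comp_hasDerivAt (z j) (hasDerivAt_update z j (z j))).deriv.symm

theorem analyticOnNhd_iterate_partialDeriv (j : Fin r) (n : ℕ) {Ω : Set (Fin r → ℂ)}
    (hΩ : IsOpen Ω) {f : (Fin r → ℂ) → ℂ} (hf : AnalyticOnNhd ℂ f Ω) :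
    AnalyticOnNhd ℂ ((partialDeriv j)^[n] f) Ω := by
  induction n with
  | zero => exact hf
  | succ n ih =>
    rw [Function.iterate_succ_apply']
    exact analyticOnNhd_partialDeriv j hΩ ih

theorem analyticOnNhd_tailPartial (α : Fin (r + 1) → ℕ) {f : (Fin (r + 1) → ℂ) → ℂ}
    {Ω : Set (Fin (r + 1) → ℂ)} (hΩ : IsOpen Ω) (hf : AnalyticOnNhd ℂ f Ω) :
    AnalyticOnNhd ℂ (tailPartial α f) Ω := by
  unfold tailPartial
  induction List.finRange r with
  | nil => exact hf
  | cons j l ih => exact analyticOnNhd_iterate_partialDeriv _ _ hΩ ih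

theorem analyticAt_cons {E : Type*} [NormedAddCommGroup E] [NormedSpace ℂ E] {g : E → ℂ}
    {h : E → Fin r → ℂ} {x : E} (hg : AnalyticAt ℂ g x) (hh : AnalyticAt ℂ h x) :
    AnalyticAt ℂ (fun x => (Fin.cons (g x) (h x) : Fin (r + 1) → ℂ)) x :=
  ((Fin.consEquivL ℂ fun _ : Fin (r + 1) => ℂ).toContinuousLinearMap.analyticAt _).comp
    (hg.prod hh)

end Slices

/-! ### Multiple contour integrals: Fubini and Cauchy's formula in several variables. -/

theorem continuousOn_contour_integrand {r : ℕ} {E : Type*} [NormedAddCommGroup E]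
    [NormedSpace ℂ E] {Γ : Fin r → Cycle} {F : (Fin r → ℂ) → E}
    (hF : ContinuousOn F (Set.univ.pi fun j => (Γ j).image)) (c : ∀ j, Fin (Γ j).n) :
    ContinuousOn (fun t : Fin r → ℝ => (∏ j, deriv ((Γ j).arc (c j)) (t j)) •
      F fun j => (Γ j).arc (c j) (t j)) (Set.Icc 0 1) := by
  refine ContinuousOn.smul (Continuous.continuousOn ?_) (hF.comp (Continuous.continuousOn ?_) ?_)
  · exact continuous_finsetProd _ fun j _ =>
      ((Γ j).continuous_deriv_arc (c j)).comp (continuous_apply j)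
  · exact continuous_pi fun j => ((Γ j).contDiff (c j)).continuous.comp (continuous_apply j)
  · exact fun t ht j _ => Cycle.arc_mem_image _ ⟨ht.1 j, ht.2 j⟩

theorem integrableOn_contour_integrand {r : ℕ} {E : Type*} [NormedAddCommGroup E]
    [NormedSpace ℂ E] {Γ : Fin r → Cycle} {F : (Fin r → ℂ) → E}
    (hF : ContinuousOn F (Set.univ.pi fun j => (Γ j).image)) (c : ∀ j, Fin (Γ j).n) :
    MeasureTheory.IntegrableOn (fun t : Fin r → ℝ => (∏ j, deriv ((Γ j).arc (c j)) (t j)) •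
      F fun j => (Γ j).arc (c j) (t j)) (Set.Icc 0 1) :=
  (continuousOn_contour_integrand hF c).integrableOn_compact isCompact_Icc

theorem contourIntegral_congr {r : ℕ} {E : Type*} [NormedAddCommGroup E]
    [NormedSpace ℂ E] {Γ : Fin r → Cycle} {F G : (Fin r → ℂ) → E}
    (h : Set.EqOn F G (Set.univ.pi fun j => (Γ j).image)) :
    contourIntegral Γ F = contourIntegral Γ G := by
  refine Finset.sum_congr rfl fun c _ =>
    MeasureTheory.setIntegral_congr_fun measurableSet_Icc fun t ht => ?_
  simp only [h fun j _ => Cycle.arc_mem_image (c j) ⟨ht.1 j, ht.2 j⟩]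

theorem contourIntegral_const_mul {r : ℕ} {Γ : Fin r → Cycle} (a : ℂ) (F : (Fin r → ℂ) → ℂ) :
    contourIntegral Γ (fun z => a * F z) = a * contourIntegral Γ F := by
  simp only [contourIntegral, Finset.mul_sum]
  refine Finset.sum_congr rfl fun c _ => ?_
  rw [← MeasureTheory.integral_const_mul]
  congr 1
  funext t
  simp only [smul_eq_mul]
  ring

/-- Fubini after splitting off the first coordinate. The integrability half lets
`contourIntegral_succ` exchange the outer integral with the sum over arcs. -/
theorem setIntegral_Icc_cons {r : ℕ} {G : (Fin (r + 1) → ℝ) → ℂ}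
    (hG : MeasureTheory.IntegrableOn G (Set.Icc 0 1)) :
    (∫ t in Set.Icc (0 : Fin (r + 1) → ℝ) 1, G t) =
      (∫ s in (0 : ℝ)..1, ∫ t in Set.Icc (0 : Fin r → ℝ) 1, G (Fin.cons s t)) ∧
    IntervalIntegrable (fun s => ∫ t in Set.Icc (0 : Fin r → ℝ) 1, G (Fin.cons s t))
      MeasureTheory.volume 0 1 := by
  set e : ℝ × (Fin r → ℝ) ≃ᵐ (Fin (r + 1) → ℝ) :=
    (MeasurableEquiv.piFinSuccAbove (fun _ => ℝ) 0).symm with he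
  have hem : MeasureTheory.MeasurePreserving e :=
    (MeasureTheory.volume_preserving_piFinSuccAbove (fun _ : Fin (r + 1) => ℝ) 0).symm _
  have hee : ∀ p, e p = Fin.cons p.1 p.2 := fun p => by
    simp [he, MeasurableEquiv.piFinSuccAbove_symm_apply, Fin.insertNthEquiv]
  have hpre : e ⁻¹' Set.Icc 0 1 = Set.Icc (0 : ℝ) 1 ×ˢ Set.Icc (0 : Fin r → ℝ) 1 := by
    ext p
    simp only [Set.mem_preimage, hee, Set.mem_prod, Set.mem_Icc, Pi.le_def, Fin.forall_fin_succ,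
      Fin.cons_zero, Fin.cons_succ, Pi.zero_apply, Pi.one_apply]
    tauto
  have hint : MeasureTheory.IntegrableOn (fun p : ℝ × (Fin r → ℝ) => G (Fin.cons p.1 p.2))
      (Set.Icc (0 : ℝ) 1 ×ˢ Set.Icc (0 : Fin r → ℝ) 1) := by
    simp only [← hee, ← hpre]
    exact (hem.integrableOn_comp_preimage e.measurableEmbedding).2 hG
  rw [MeasureTheory.Measure.volume_eq_prod] at hint
  constructor
  · rw [← hem.setIntegral_preimage_emb e.measurableEmbedding, hpre,
      MeasureTheory.Measure.volume_eq_prod, intervalIntegral.integral_of_le zero_le_one,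
      ← MeasureTheory.integral_Icc_eq_integral_Ioc]
    simp only [hee]
    exact MeasureTheory.setIntegral_prod _ hint
  · rw [intervalIntegrable_iff, Set.uIoc_of_le zero_le_one]
    rw [MeasureTheory.IntegrableOn, ← MeasureTheory.Measure.prod_restrict] at hint
    exact MeasureTheory.IntegrableOn.mono_set hint.integral_prod_left Set.Ioc_subset_Icc_self

/-- A multiple contour integral as an iterated integral. -/
theorem contourIntegral_succ {r : ℕ} {Γ : Fin (r + 1) → Cycle} {F : (Fin (r + 1) → ℂ) → ℂ}
    (hF : ContinuousOn F (Set.univ.pi fun j => (Γ j).image)) :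
    contourIntegral Γ F = (Γ 0).integral fun a =>
      contourIntegral (fun j => Γ j.succ) fun z => F (Fin.cons a z) := by
  have hcons : ∀ (i : Fin (Γ 0).n) (c : ∀ j : Fin r, Fin (Γ j.succ).n) (s : ℝ) (t : Fin r → ℝ),
      ((∏ j, deriv ((Γ j).arc ((Fin.cons i c : ∀ j, Fin (Γ j).n) j))
        ((Fin.cons s t : Fin (r + 1) → ℝ) j)) • F fun j =>
          (Γ j).arc ((Fin.cons i c : ∀ j, Fin (Γ j).n) j) ((Fin.cons s t : Fin (r + 1) → ℝ) j)) =
      (deriv ((Γ 0).arc i) s * ∏ j, deriv ((Γ j.succ).arc (c j)) (t j)) *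
        F (Fin.cons ((Γ 0).arc i s) fun j => (Γ j.succ).arc (c j) (t j)) := by
    intro i c s t
    rw [Fin.prod_univ_succ, smul_eq_mul]
    congr 2
    funext j
    refine Fin.cases ?_ (fun j => ?_) j <;> rfl
  have h1 : contourIntegral Γ F = ∑ i, ∑ c : ∀ j : Fin r, Fin (Γ j.succ).n,
      ∫ s in (0 : ℝ)..1, ∫ t in Set.Icc (0 : Fin r → ℝ) 1,
        (deriv ((Γ 0).arc i) s * ∏ j, deriv ((Γ j.succ).arc (c j)) (t j)) *
          F (Fin.cons ((Γ 0).arc i s) fun j => (Γ j.succ).arc (c j) (t j)) := by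
    rw [contourIntegral, ← Equiv.sum_comp (Fin.consEquiv fun j => Fin (Γ j).n),
      Fintype.sum_prod_type]
    refine Finset.sum_congr rfl fun i _ => Finset.sum_congr rfl fun c _ => ?_
    have h2 := (setIntegral_Icc_cons (integrableOn_contour_integrand hF (Fin.cons i c))).1
    simp only [hcons] at h2
    exact h2
  rw [h1]
  refine Finset.sum_congr rfl fun i _ => ?_
  rw [← intervalIntegral.integral_finsetSum]
  · refine intervalIntegral.integral_congr fun s _ => ?_
    simp only [contourIntegral, Finset.mul_sum, ← MeasureTheory.integral_const_mul, smul_eq_mul,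
      mul_assoc]
  · intro c _
    have h2 := (setIntegral_Icc_cons (integrableOn_contour_integrand hF (Fin.cons i c))).2
    simpa only [hcons] using h2

/-- Cauchy's integral formula for the mixed partial derivatives of a function of several
variables. -/
theorem contourIntegral_mul_prod_inv_sub_pow : ∀ {r : ℕ} {Γ : Fin r → Cycle} {U : Fin r → Set ℂ}
    (_ : ∀ j, IsOpen (U j)) (_ : ∀ j, (Γ j).image ⊆ U j)
    (_ : ∀ j, ∀ w ∉ U j, (Γ j).index w = 0) {w : Fin r → ℂ} (_ : ∀ j, w j ∈ U j)
    (_ : ∀ j, w j ∉ (Γ j).image) (_ : ∀ j, (Γ j).index (w j) = 1) (α : Fin r → ℕ)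
    {f : (Fin r → ℂ) → ℂ} (_ : AnalyticOnNhd ℂ f (Set.univ.pi U)),
    contourIntegral Γ (fun z => f z * ∏ j, (z j - w j)⁻¹ ^ (α j + 1)) =
      (2 * Real.pi * Complex.I) ^ r * (mixedPartial α f w / ((∏ j, (α j)! : ℕ) : ℂ)) := by
  intro r
  induction r with
  | zero =>
    intro Γ U _ _ _ w _ _ _ α f _
    have h : ∀ z, f z = f w := fun z => by rw [Subsingleton.elim z w]
    have h0 : MeasureTheory.volume.real (Set.Icc ![] (1 : Fin 0 → ℝ)) = 1 := by
      simp [MeasureTheory.Measure.real, Real.volume_Icc_pi]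
    simp [contourIntegral, mixedPartial, h, h0]
  | succ r ih =>
    intro Γ U hU hΓU hind w hw hwΓ hw1 α f hf
    have hopen : IsOpen (Set.univ.pi U) := isOpen_set_pi Set.finite_univ fun j _ => hU j
    have hcons : ∀ a ∈ U 0, ∀ z ∈ Set.univ.pi fun j : Fin r => U j.succ,
        (Fin.cons a z : Fin (r + 1) → ℂ) ∈ Set.univ.pi U := fun a ha z hz j _ => by
      refine Fin.cases ?_ (fun j => ?_) j
      · exact ha
      · exact hz j trivial
    rw [contourIntegral_succ]
    -- By induction, the integrals over the last `r` variables turn the integrand into a constant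
    -- times `g a` over a power of `a - w 0`. The one-variable formula for `g` then finishes.
    · set g : ℂ → ℂ := fun a => tailPartial α f (Fin.cons a fun j => w j.succ) with hg
      have h1 : Set.EqOn (fun a => contourIntegral (fun j => Γ j.succ) fun z =>
          f (Fin.cons a z) * ∏ j, ((Fin.cons a z : Fin (r + 1) → ℂ) j - w j)⁻¹ ^ (α j + 1))
          (fun a => (2 * Real.pi * Complex.I) ^ r * ((∏ j : Fin r, (α j.succ)! : ℕ) : ℂ)⁻¹ *
            (g a * (a - w 0)⁻¹ ^ (α 0 + 1))) (Γ 0).image := fun a ha => by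
        have h2 := ih (fun j => hU j.succ) (fun j => hΓU j.succ) (fun j => hind j.succ)
          (fun j => hw j.succ) (fun j => hwΓ j.succ) (fun j => hw1 j.succ) (fun j => α j.succ)
          (f := fun z => f (Fin.cons a z)) fun z hz =>
            (hf _ (hcons a (hΓU 0 ha) z hz)).comp (analyticAt_cons analyticAt_const analyticAt_id)
        rw [← tailPartial_cons] at h2
        have h3 : ∀ z : Fin r → ℂ, f (Fin.cons a z) *
            ∏ j, ((Fin.cons a z : Fin (r + 1) → ℂ) j - w j)⁻¹ ^ (α j + 1) =
            (a - w 0)⁻¹ ^ (α 0 + 1) * (f (Fin.cons a z) *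
              ∏ j : Fin r, (z j - w j.succ)⁻¹ ^ (α j.succ + 1)) := fun z => by
          rw [Fin.prod_univ_succ]
          simp only [Fin.cons_zero, Fin.cons_succ]
          ring
        simp only [h3, contourIntegral_const_mul, h2, hg]
        ring
      have hgd : DifferentiableOn ℂ g (U 0) := fun a ha =>
        (AnalyticAt.fun_comp (x := a)
          (f := fun a => (Fin.cons a fun j => w j.succ : Fin (r + 1) → ℂ))
          (analyticOnNhd_tailPartial α hopen hf _
          (hcons a ha _ fun j _ => hw j.succ)) (analyticAt_cons (g := fun a => a)
            (h := fun _ j => w j.succ) analyticAt_id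
              analyticAt_const)).differentiableAt.differentiableWithinAt
      rw [Cycle.integral_congr h1, Cycle.integral_const_mul,
        Cycle.integral_mul_inv_sub_pow (hU 0) (hΓU 0) (hind 0) (hw 0) (hwΓ 0) (α 0) hgd, hw1 0,
        mixedPartial_succ]
      have h4 : iteratedDeriv (α 0) g (w 0) = (partialDeriv 0)^[α 0] (tailPartial α f) w := by
        rw [hg, ← iterate_partialDeriv_zero_cons]
        exact congrArg _ (Fin.cons_self_tail w)
      rw [h4, Fin.prod_univ_succ]
      push_cast
      rw [pow_succ]
      field_simp
    · refine ((hf.continuousOn).mono (Set.pi_mono fun j _ => hΓU j)).mul ?_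
      refine continuousOn_finsetProd _ fun j _ => ContinuousOn.pow ?_ _
      exact ((continuous_apply j).sub continuous_const).continuousOn.inv₀ fun z hz h =>
        hwΓ j ((show z j = w j from sub_eq_zero.1 h) ▸ hz j trivial)

/-! ### Operators on the Hilbert tensor product -/

section TensorOperators

variable {r : ℕ} {H : Fin r → Type u} [∀ j, NormedAddCommGroup (H j)]
  [∀ j, InnerProductSpace ℂ (H j)]

theorem ext_inner_tprod {v w : HilbertTensor H}
    (h : ∀ x : ∀ j, H j, inner ℂ (tprod x : HilbertTensor H) v = inner ℂ (tprod x) w) : v = w := by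
  refine (dense_span_tprod (H := H)).eq_of_inner_right ℂ ?_
  rintro y hy
  induction hy using Submodule.span_induction with
  | mem y hy =>
    obtain ⟨x, rfl⟩ := hy
    exact h x
  | zero => simp
  | add a b _ _ ha hb => rw [inner_add_left, inner_add_left, ha, hb]
  | smul c a _ ha => rw [inner_smul_left, inner_smul_left, ha]

/-- The elementary tensors as values of a multilinear map. -/
def tprodMultilinear : MultilinearMap ℂ H (HilbertTensor H) where
  toFun := tprod
  map_update_add' x i a b := by
    -- Tested against elementary tensors, additivity becomes that of a product of scalars, and the
    -- recursive construction need not be unfolded.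
    refine ext_inner_tprod fun y => ?_
    have := ((MultilinearMap.mkPiAlgebra ℂ (Fin r) ℂ).compLinearMap
      fun j => innerₛₗ ℂ (y j)).map_update_add x i a b
    rw [inner_add_right, inner_tprod, inner_tprod, inner_tprod]
    exact this
  map_update_smul' x i c a := by
    refine ext_inner_tprod fun y => ?_
    have := ((MultilinearMap.mkPiAlgebra ℂ (Fin r) ℂ).compLinearMap
      fun j => innerₛₗ ℂ (y j)).map_update_smul x i c a
    rw [inner_smul_right, inner_tprod, inner_tprod]
    exact this

theorem tprodMultilinear_apply (x : ∀ j, H j) :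
    tprodMultilinear x = (tprod x : HilbertTensor H) := rfl

theorem norm_tprod (x : ∀ j, H j) : ‖(tprod x : HilbertTensor H)‖ = ∏ j, ‖x j‖ := by
  have h : (‖(tprod x : HilbertTensor H)‖ : ℂ) ^ 2 = ((∏ j, ‖x j‖ : ℝ) : ℂ) ^ 2 := by
    have h1 := inner_self_eq_norm_sq_to_K (𝕜 := ℂ) (tprod x : HilbertTensor H)
    rw [inner_tprod] at h1
    simp only [inner_self_eq_norm_sq_to_K, Finset.prod_pow] at h1
    rw [Complex.ofReal_prod]
    exact h1.symm
  have h2 : ‖(tprod x : HilbertTensor H)‖ ^ 2 = (∏ j, ‖x j‖) ^ 2 := by exact_mod_cast h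
  exact (pow_left_inj₀ (norm_nonneg _) (Finset.prod_nonneg fun j _ => norm_nonneg _)
    two_ne_zero).1 h2

theorem continuous_tprod : Continuous (tprod : (∀ j, H j) → HilbertTensor H) :=
  ((tprodMultilinear (H := H)).mkContinuous 1 fun x => by
    rw [one_mul, tprodMultilinear_apply, norm_tprod]).cont

theorem ext_tprod {S T : HilbertTensor H →L[ℂ] HilbertTensor H}
    (h : ∀ x : ∀ j, H j, S (tprod x) = T (tprod x)) : S = T :=
  ContinuousLinearMap.ext_on dense_span_tprod (by rintro _ ⟨x, rfl⟩; exact h x)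

theorem tensorMap_mul (S T : ∀ j, H j →L[ℂ] H j) :
    tensorMap (fun j => S j * T j) = tensorMap S * tensorMap T :=
  ext_tprod fun x => by
    rw [mul_apply_eq_comp, tensorMap_tprod, tensorMap_tprod, tensorMap_tprod]
    rfl

theorem tensorMap_sum_smul {κ : Fin r → Type*} [∀ j, DecidableEq (κ j)] (s : ∀ j, Finset (κ j))
    (c : ∀ j, κ j → ℂ) (T : ∀ j, κ j → (H j →L[ℂ] H j)) :
    tensorMap (fun j => ∑ m ∈ s j, c j m • T j m) =
      ∑ α ∈ Fintype.piFinset s, (∏ j, c j (α j)) • tensorMap fun j => T j (α j) :=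
  ext_tprod fun x => by
    rw [tensorMap_tprod, sum_apply]
    simp only [sum_apply, smul_apply, tensorMap_tprod]
    rw [← tprodMultilinear_apply, MultilinearMap.map_sum_finset]
    refine Finset.sum_congr rfl fun α _ => ?_
    rw [MultilinearMap.map_smul_univ]
    rfl

theorem lift_tprod (j : Fin r) (T : H j →L[ℂ] H j) (x : ∀ j, H j) :
    lift j T (tprod x) = tprod (Function.update x j (T (x j))) := by
  rw [lift, tensorMap_tprod]
  congr 1
  funext i
  rcases eq_or_ne i j with rfl | h
  · simp
  · simp [h]

/-- Lifting operators from a factor to the tensor product is a homomorphism of algebras. -/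
def liftHom (j : Fin r) : (H j →L[ℂ] H j) →ₐ[ℂ] (HilbertTensor H →L[ℂ] HilbertTensor H) where
  toFun := lift j
  map_one' := ext_tprod fun x => by simp [lift_tprod]
  map_mul' S T := ext_tprod fun x => by simp [lift_tprod]
  map_zero' := ext_tprod fun x => by
    rw [lift_tprod, ← tprodMultilinear_apply]
    exact tprodMultilinear.map_update_zero x j
  map_add' S T := ext_tprod fun x => by
    rw [add_apply, lift_tprod, lift_tprod, lift_tprod]
    exact tprodMultilinear.map_update_add x j _ _
  commutes' c := ext_tprod fun x => by
    rw [lift_tprod]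
    have := tprodMultilinear.map_update_smul x j c (x j)
    rw [Function.update_eq_self] at this
    rw [Algebra.algebraMap_eq_smul_one, Algebra.algebraMap_eq_smul_one, smul_apply, smul_apply]
    exact this

theorem liftHom_apply (j : Fin r) (T : H j →L[ℂ] H j) : liftHom j T = lift j T := rfl

theorem norm_algTensorMap_le : ∀ {r : ℕ} {H : Fin r → Type u} [∀ j, NormedAddCommGroup (H j)]
    [∀ j, InnerProductSpace ℂ (H j)] (T : ∀ j, H j →L[ℂ] H j),
    ‖algTensorMap T‖ ≤ ∏ j, ‖T j‖ := by
  intro r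
  induction r with
  | zero =>
    intro H _ _ T
    rw [Fin.prod_univ_zero]
    exact ContinuousLinearMap.norm_id_le
  | succ r ih =>
    intro H _ _ T
    rw [Fin.prod_univ_succ]
    refine le_trans (TensorProduct.norm_mapL_le (T 0)
      (algTensorMap (H := fun j => H j.succ) fun j => T j.succ)) ?_
    exact mul_le_mul_of_nonneg_left (ih (H := fun j => H j.succ) fun j => T j.succ) (norm_nonneg _)

/-- The other factors are identities, of norm at most `1`; the norm is `0` on a trivial space. -/
theorem norm_lift_le (j : Fin r) (T : H j →L[ℂ] H j) : ‖lift j T‖ ≤ ‖T‖ := by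
  have h1 : ‖lift j T‖ ≤
      ∏ i, ‖Function.update (fun i => ContinuousLinearMap.id ℂ (H i)) j T i‖ := by
    refine le_trans (ContinuousLinearMap.opNorm_le_bound _ (norm_nonneg _) fun v => ?_)
      (norm_algTensorMap_le (Function.update (fun i => ContinuousLinearMap.id ℂ (H i)) j T))
    induction v using UniformSpace.Completion.induction_on with
    | hp => exact isClosed_le (by fun_prop) (by fun_prop)
    | ih v =>
      rw [lift, tensorMap, ContinuousLinearMap.completion_apply_coe,
        UniformSpace.Completion.norm_coe, UniformSpace.Completion.norm_coe]
      exact ContinuousLinearMap.le_opNorm _ _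
  refine h1.trans ?_
  rw [← Finset.mul_prod_erase _ _ (Finset.mem_univ j), Function.update_self]
  refine mul_le_of_le_one_right (norm_nonneg _) (Finset.prod_le_one (fun i _ => norm_nonneg _)
    fun i hi => ?_)
  rw [Function.update_of_ne (Finset.ne_of_mem_erase hi)]
  exact ContinuousLinearMap.norm_id_le

theorem prod_lift_tprod (T : ∀ j, H j →L[ℂ] H j) {l : List (Fin r)} (hl : l.Nodup) (x : ∀ j, H j) :
    (l.map fun j => lift j (T j)).prod (tprod x) =
      tprod fun j => if j ∈ l then T j (x j) else x j := by
  induction l with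
  | nil => simp
  | cons i l ih =>
    rw [List.nodup_cons] at hl
    rw [List.map_cons, List.prod_cons, mul_apply_eq_comp, ih hl.2, lift_tprod]
    congr 1
    funext j
    rcases eq_or_ne j i with rfl | h
    · simp [hl.1]
    · simp [h]

/-- The tensor product of operators is the product of their lifts. -/
theorem prod_ofFn_lift (T : ∀ j, H j →L[ℂ] H j) :
    (List.ofFn fun j => lift j (T j)).prod = tensorMap T :=
  ext_tprod fun x => by
    rw [List.ofFn_eq_map, prod_lift_tprod T (List.nodup_finRange r), tensorMap_tprod]
    simp

/-- Lifting is a unital algebra homomorphism, hence carries inverses to inverses. -/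
theorem resolvent_lift (j : Fin r) (T : H j →L[ℂ] H j) {z : ℂ} (hz : z ∉ spectrum ℂ T) :
    resolvent (lift j T) z = lift j (resolvent T z) := by
  have h1 : IsUnit (algebraMap ℂ (H j →L[ℂ] H j) z - T) := spectrum.notMem_iff.1 hz
  have h2 : algebraMap ℂ _ z - lift j T = liftHom j (algebraMap ℂ _ z - T) := by
    rw [map_sub, AlgHom.commutes, liftHom_apply]
  rw [resolvent, resolvent, h2, ← liftHom_apply]
  obtain ⟨a, ha⟩ := h1
  rw [← ha, Ring.inverse_unit]
  exact Ring.inverse_unit (Units.map (liftHom (H := H) j).toMonoidHom a)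

theorem notMem_spectrum_lift (j : Fin r) (T : H j →L[ℂ] H j) {z : ℂ} (hz : z ∉ spectrum ℂ T) :
    z ∉ spectrum ℂ (lift j T) := fun h =>
  hz (AlgHom.spectrum_apply_subset (liftHom j) T h)

end TensorOperators

/-! ### Unconditional convergence of tensor products of families of projections -/

section SignBounded

variable {E : Type*} [NormedAddCommGroup E] [InnerProductSpace ℂ E] {ι : Type*}

/-- The signed finite sums of a family of operators are bounded by `C`. -/
def SignBounded (A : ι → E →L[ℂ] E) (C : ℝ) : Prop :=
  ∀ (s : Finset ι) (ε : ι → ℝ), (∀ k, ε k = 1 ∨ ε k = -1) → ‖∑ k ∈ s, (ε k : ℂ) • A k‖ ≤ C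

/-- Signs can be chosen so that a sum is at least as long as for orthogonal terms. -/
theorem exists_signs (s : Finset ι) (v : ι → E) : ∃ ε : ι → ℝ, (∀ k, ε k = 1 ∨ ε k = -1) ∧
    ∑ k ∈ s, ‖v k‖ ^ 2 ≤ ‖∑ k ∈ s, (ε k : ℂ) • v k‖ ^ 2 := by
  classical
  induction s using Finset.induction_on with
  | empty => exact ⟨fun _ => 1, fun _ => Or.inl rfl, by simp⟩
  | insert a s ha ih =>
    obtain ⟨ε, hε, h⟩ := ih
    set w := ∑ k ∈ s, (ε k : ℂ) • v k with hw
    -- The new sign makes the cross term with the previous sum nonnegative.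
    obtain ⟨δ, hδ, hp⟩ : ∃ δ : ℝ, (δ = 1 ∨ δ = -1) ∧
        0 ≤ RCLike.re (inner ℂ ((δ : ℂ) • v a) w) := by
      rcases le_total 0 (RCLike.re (inner ℂ (v a) w)) with h0 | h0
      · exact ⟨1, Or.inl rfl, by simpa using h0⟩
      · exact ⟨-1, Or.inr rfl, by simpa using h0⟩
    refine ⟨Function.update ε a δ, fun k => ?_, ?_⟩
    · rcases eq_or_ne k a with rfl | hk
      · simpa using hδ
      · simpa [hk] using hε k
    · have h0 : ∑ k ∈ s, (Function.update ε a δ k : ℂ) • v k = w :=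
        Finset.sum_congr rfl fun k hk => by
          rw [Function.update_of_ne (ne_of_mem_of_not_mem hk ha)]
      rw [Finset.sum_insert ha, Finset.sum_insert ha, Function.update_self, h0,
        norm_add_sq (𝕜 := ℂ), norm_smul]
      have h1 : ‖(δ : ℂ)‖ = 1 := by rcases hδ with rfl | rfl <;> simp
      rw [h1, one_mul]
      linarith

theorem SignBounded.sum_norm_sq_le {A : ι → E →L[ℂ] E} {C : ℝ} (hA : SignBounded A C)
    (s : Finset ι) (x : E) : ∑ k ∈ s, ‖A k x‖ ^ 2 ≤ C ^ 2 * ‖x‖ ^ 2 := by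
  obtain ⟨ε, hε, h⟩ := exists_signs s fun k => A k x
  refine h.trans ?_
  have h1 : ∑ k ∈ s, (ε k : ℂ) • A k x = (∑ k ∈ s, (ε k : ℂ) • A k) x := by
    simp [sum_apply]
  rw [h1, ← mul_pow]
  exact pow_le_pow_left₀ (norm_nonneg _) (ContinuousLinearMap.le_of_opNorm_le _ (hA s ε hε) x) 2

/-- Signs are real, so the adjoint of a signed sum is the signed sum of the adjoints. -/
theorem SignBounded.adjoint [CompleteSpace E] {A : ι → E →L[ℂ] E} {C : ℝ} (hA : SignBounded A C) :
    SignBounded (fun k => star (A k)) C := fun s ε hε => by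
  rw [← norm_star]
  simpa using hA s ε hε

/-- At each vector, summability bounds all finite sums: outside a fixed finite set they contribute
at most `1`. Banach–Steinhaus makes the bound uniform, and a signed sum is a difference of two such
sums, whence `C + C`. -/
theorem exists_signBounded [CompleteSpace E] {A : ι → E →L[ℂ] E}
    (hA : ∀ x, Summable fun k => A k x) : ∃ C, SignBounded A C := by
  classical
  have h1 : ∀ x, ∃ C, ∀ s : Finset ι, ‖(∑ k ∈ s, A k) x‖ ≤ C := fun x => by
    obtain ⟨s₀, hs₀⟩ := summable_iff_vanishing_norm.1 (hA x) 1 one_pos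
    refine ⟨∑ k ∈ s₀, ‖A k x‖ + 1, fun s => ?_⟩
    rw [sum_apply, ← Finset.sum_inter_add_sum_sdiff s s₀]
    refine (norm_add_le _ _).trans (add_le_add ?_ (hs₀ _ Finset.sdiff_disjoint).le)
    exact (norm_sum_le _ _).trans (Finset.sum_le_sum_of_subset_of_nonneg Finset.inter_subset_right
      fun _ _ _ => norm_nonneg _)
  obtain ⟨C, hC⟩ := banach_steinhaus h1
  refine ⟨C + C, fun s ε hε => ?_⟩
  rw [← Finset.sum_filter_add_sum_filter_not s fun k => ε k = 1]
  refine (norm_add_le _ _).trans (add_le_add ?_ ?_)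
  · rw [Finset.sum_congr rfl fun k hk => by
      rw [(Finset.mem_filter.1 hk).2, Complex.ofReal_one, one_smul]]
    exact hC _
  · rw [Finset.sum_congr rfl fun k hk => by
      rw [(hε k).resolve_left (Finset.mem_filter.1 hk).2, Complex.ofReal_neg, Complex.ofReal_one,
        neg_one_smul], Finset.sum_neg_distrib, norm_neg]
    exact hC _

theorem sum_piFinset_succ {r : ℕ} {κ : Fin (r + 1) → Type*} (s : ∀ j, Finset (κ j))
    (g : (∀ j, κ j) → ℝ) : ∑ k ∈ Fintype.piFinset s, g k =
      ∑ a ∈ s 0, ∑ k ∈ Fintype.piFinset fun j : Fin r => s j.succ, g (Fin.cons a k) := by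
  classical
  rw [← Finset.sum_product']
  refine Finset.sum_bij' (fun k _ => (k 0, fun j => k j.succ)) (fun p _ => Fin.cons p.1 p.2)
    ?_ ?_ ?_ ?_ ?_
  · intro k hk
    simp only [Fintype.mem_piFinset, Finset.mem_product] at hk ⊢
    exact ⟨hk 0, fun j => hk j.succ⟩
  · intro p hp
    simp only [Fintype.mem_piFinset, Finset.mem_product, Fin.forall_fin_succ] at hp ⊢
    exact hp
  · intro k _
    exact Fin.cons_self_tail k
  · intro p _
    rfl
  · intro k _
    exact congrArg g (Fin.cons_self_tail k).symm

/-- For a fixed tail of indices, the first family's square function bound is applied to the vector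
produced by the tail, so the first index is summed innermost. The vector `x` stays fixed in the
induction. -/
theorem sum_norm_sq_prod_le (x : E) : ∀ {r : ℕ} {κ : Fin r → Type*} {B : ∀ j, κ j → E →L[ℂ] E}
    {C : Fin r → ℝ} (_ : ∀ j, SignBounded (B j) (C j)) (s : ∀ j, Finset (κ j)),
    ∑ k ∈ Fintype.piFinset s, ‖(List.ofFn fun j => B j (k j)).prod x‖ ^ 2 ≤
      (∏ j, C j ^ 2) * ‖x‖ ^ 2 := by
  intro r
  induction r with
  | zero =>
    intro κ B C _ s
    simp [Fintype.piFinset_of_isEmpty]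
  | succ r ih =>
    intro κ B C hB s
    rw [sum_piFinset_succ, Finset.sum_comm, Fin.prod_univ_succ, mul_assoc]
    simp only [List.ofFn_succ, List.prod_cons, Fin.cons_zero, Fin.cons_succ, mul_apply_eq_comp]
    calc _ ≤ ∑ k ∈ Fintype.piFinset fun j : Fin r => s j.succ,
          C 0 ^ 2 * ‖(List.ofFn fun j : Fin r => B j.succ (k j)).prod x‖ ^ 2 :=
        Finset.sum_le_sum fun k _ => (hB 0).sum_norm_sq_le (s 0) _
      _ ≤ _ := by
        rw [← Finset.mul_sum]
        exact mul_le_mul_of_nonneg_left (ih (fun j => hB j.succ) fun j => s j.succ) (sq_nonneg _)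

/-- The adjoint reverses the product: the first family now acts on `x` directly, and the induction
hypothesis is needed at the moving vector `star (B 0 a) x`. -/
theorem sum_norm_sq_star_prod_le [CompleteSpace E] : ∀ {r : ℕ} {κ : Fin r → Type*}
    {B : ∀ j, κ j → E →L[ℂ] E} {C : Fin r → ℝ} (_ : ∀ j, SignBounded (B j) (C j))
    (s : ∀ j, Finset (κ j)) (x : E),
    ∑ k ∈ Fintype.piFinset s, ‖star (List.ofFn fun j => B j (k j)).prod x‖ ^ 2 ≤
      (∏ j, C j ^ 2) * ‖x‖ ^ 2 := by
  intro r
  induction r with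
  | zero =>
    intro κ B C _ s
    simp [Fintype.piFinset_of_isEmpty]
  | succ r ih =>
    intro κ B C hB s x
    rw [sum_piFinset_succ, Fin.prod_univ_succ]
    simp only [List.ofFn_succ, List.prod_cons, Fin.cons_zero, Fin.cons_succ, star_mul,
      mul_apply_eq_comp]
    calc _ ≤ ∑ a ∈ s 0, (∏ j : Fin r, C j.succ ^ 2) * ‖star (B 0 a) x‖ ^ 2 :=
        Finset.sum_le_sum fun a _ => ih (fun j => hB j.succ) (fun j => s j.succ) _
      _ ≤ _ := by
        rw [← Finset.mul_sum, mul_comm (C 0 ^ 2), mul_assoc]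
        exact mul_le_mul_of_nonneg_left ((hB 0).adjoint.sum_norm_sq_le _ _)
          (Finset.prod_nonneg fun _ _ => sq_nonneg _)

/-- Partial sums of a family of idempotents are bounded if the square functions of the family and
of the family of adjoints are. -/
theorem norm_sum_le_of_sum_norm_sq_le [CompleteSpace E] {R : ι → E →L[ℂ] E} {F : Finset ι} {M : ℝ}
    (hM : 0 ≤ M) (hR : ∀ k ∈ F, R k * R k = R k) (h1 : ∀ x, ∑ k ∈ F, ‖R k x‖ ^ 2 ≤ M * ‖x‖ ^ 2)
    (h2 : ∀ x, ∑ k ∈ F, ‖star (R k) x‖ ^ 2 ≤ M * ‖x‖ ^ 2) (x : E) :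
    ‖∑ k ∈ F, R k x‖ ≤ M * ‖x‖ := by
  set y := ∑ k ∈ F, R k x with hy
  -- Idempotency allows one copy of `R k` to be moved to the other side of the inner product.
  -- Cauchy–Schwarz for sums then uses both square functions, and a factor `‖y‖ ^ 2` cancels.
  have h3 : ‖y‖ ^ 2 ≤ ∑ k ∈ F, ‖star (R k) y‖ * ‖R k x‖ := by
    have h4 : (inner ℂ y y : ℂ) = ∑ k ∈ F, inner ℂ (star (R k) y) (R k x) := by
      conv_lhs => rw [hy, ← hy, inner_sum]
      refine Finset.sum_congr rfl fun k hk => ?_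
      rw [ContinuousLinearMap.star_eq_adjoint, ContinuousLinearMap.adjoint_inner_left,
        ← mul_apply_eq_comp, hR k hk]
    have h5 : ‖y‖ ^ 2 = ‖(inner ℂ y y : ℂ)‖ := by
      rw [inner_self_eq_norm_sq_to_K]
      simp
    rw [h5, h4]
    exact (norm_sum_le _ _).trans (Finset.sum_le_sum fun k _ => norm_inner_le_norm _ _)
  have h6 := Finset.sum_mul_sq_le_sq_mul_sq F (fun k => ‖star (R k) y‖) fun k => ‖R k x‖
  have h7 : (‖y‖ ^ 2) ^ 2 ≤ (M * ‖y‖ ^ 2) * (M * ‖x‖ ^ 2) :=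
    (pow_le_pow_left₀ (sq_nonneg _) h3 2).trans (h6.trans (mul_le_mul (h2 y) (h1 x)
      (Finset.sum_nonneg fun _ _ => sq_nonneg _) (by positivity)))
  rcases (norm_nonneg y).eq_or_lt with h0 | h0
  · rw [← h0]; positivity
  · have h8 : ‖y‖ ^ 2 ≤ (M * ‖x‖) ^ 2 := by
      have : ‖y‖ ^ 2 * ‖y‖ ^ 2 ≤ ‖y‖ ^ 2 * (M * ‖x‖) ^ 2 := by nlinarith
      exact le_of_mul_le_mul_left this (by positivity)
    exact le_of_sq_le_sq h8 (by positivity)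

end SignBounded

/-! ### Tensor products of resolutions of the identity. -/

section TensorSums

variable {r : ℕ} {H : Fin r → Type u} [∀ j, NormedAddCommGroup (H j)]
  [∀ j, InnerProductSpace ℂ (H j)] [∀ j, CompleteSpace (H j)] {ι : Fin r → Type v}
  {P : ∀ j, ι j → H j →L[ℂ] H j}

/-- Unconditional convergence needs arbitrary finite sets `F` of multi-indices, not only boxes.
Square functions have nonnegative terms, so they may be enlarged to a box containing `F`, where the
estimate factorizes; sums of operators could not be enlarged this way. -/
theorem exists_norm_sum_tensorMap_le (hP : ∀ j k, P j k * P j k = P j k)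
    (hsum : ∀ j x, HasSum (fun k => P j k x) x) : ∃ M : ℝ, 0 ≤ M ∧
      ∀ (F : Finset (∀ j, ι j)) (w : HilbertTensor H),
        ‖∑ k ∈ F, tensorMap (fun j => P j (k j)) w‖ ≤ M * ‖w‖ := by
  classical
  choose C hC using fun j => exists_signBounded fun x => (hsum j x).summable
  have hB : ∀ j, SignBounded (fun k => lift j (P j k)) (C j) := fun j s ε hε => by
    have h : ∑ k ∈ s, (ε k : ℂ) • lift j (P j k) = lift j (∑ k ∈ s, (ε k : ℂ) • P j k) := by
      simp only [← liftHom_apply, map_sum, map_smul]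
    rw [h]
    exact (norm_lift_le j _).trans (hC j s ε hε)
  have hF : ∀ F : Finset (∀ j, ι j), F ⊆ Fintype.piFinset fun j => F.image fun k => k j :=
    fun F k hk => Fintype.mem_piFinset.2 fun j => Finset.mem_image_of_mem (fun k => k j) hk
  refine ⟨∏ j, C j ^ 2, Finset.prod_nonneg fun _ _ => sq_nonneg _, fun F w => ?_⟩
  refine norm_sum_le_of_sum_norm_sq_le (Finset.prod_nonneg fun _ _ => sq_nonneg _)
    (fun k _ => ?_) (fun x => ?_) (fun x => ?_) w
  · rw [← tensorMap_mul]
    simp only [hP]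
  · simp only [← prod_ofFn_lift]
    exact (Finset.sum_le_sum_of_subset_of_nonneg (hF F) fun _ _ _ => sq_nonneg _).trans
      (sum_norm_sq_prod_le x hB _)
  · simp only [← prod_ofFn_lift]
    exact (Finset.sum_le_sum_of_subset_of_nonneg (hF F) fun _ _ _ => sq_nonneg _).trans
      (sum_norm_sq_star_prod_le hB _ x)

/-- Uniformly bounded partial sums that converge strongly on a set converge on its closure. -/
theorem isClosed_setOf_hasSum {E κ : Type*} [NormedAddCommGroup E] [NormedSpace ℂ E]
    {R : κ → E →L[ℂ] E} {M : ℝ} (hM : 0 ≤ M)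
    (hR : ∀ F : Finset κ, ∀ w, ‖∑ k ∈ F, R k w‖ ≤ M * ‖w‖) :
    IsClosed {w | HasSum (fun k => R k w) w} := by
  rw [← closure_subset_iff_isClosed]
  intro w hw
  rw [Metric.mem_closure_iff] at hw
  suffices h : Tendsto (fun F : Finset κ => ∑ k ∈ F, R k w) atTop (𝓝 w) by
    simpa [HasSum] using h
  rw [Metric.tendsto_nhds]
  intro ε hε
  obtain ⟨v, hv, hwv⟩ := hw (ε / (2 * (M + 1))) (by positivity)
  have h1 : Tendsto (fun F : Finset κ => ∑ k ∈ F, R k v) atTop (𝓝 v) := by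
    simpa [HasSum] using hv
  filter_upwards [Metric.tendsto_nhds.1 h1 (ε / 2) (by positivity)] with F hF
  rw [dist_eq_norm] at hF hwv ⊢
  have h2 : ∑ k ∈ F, R k w - w =
      ∑ k ∈ F, R k (w - v) + (∑ k ∈ F, R k v - v) - (w - v) := by
    simp only [map_sub, Finset.sum_sub_distrib]
    abel
  have h3 : (M + 1) * ‖w - v‖ < ε / 2 := by
    rw [lt_div_iff₀ (by positivity)] at hwv
    linarith
  have h4 := hR F (w - v)
  rw [h2]
  have h5 := norm_sub_le (∑ k ∈ F, R k (w - v) + (∑ k ∈ F, R k v - v)) (w - v)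
  have h6 := norm_add_le (∑ k ∈ F, R k (w - v)) (∑ k ∈ F, R k v - v)
  linarith

/-- On `⊗ P_{j,l_j} x_j` only one term of the series is nonzero. Elementary tensors are limits of
finite sums of such vectors, and the uniform bound makes the set of convergence closed. -/
theorem hasSum_tensorMap (hP : ∀ j k, P j k * P j k = P j k)
    (hP' : ∀ j k l, k ≠ l → P j k * P j l = 0)
    (hsum : ∀ j x, HasSum (fun k => P j k x) x) (w : HilbertTensor H) :
    HasSum (fun k : ∀ j, ι j => tensorMap (fun j => P j (k j)) w) w := by
  classical
  obtain ⟨M, hM, hb⟩ := exists_norm_sum_tensorMap_le hP hsum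
  have hclosed := isClosed_setOf_hasSum hM hb
  set D : Submodule ℂ (HilbertTensor H) :=
    { carrier := {w | HasSum (fun k : ∀ j, ι j => tensorMap (fun j => P j (k j)) w) w}
      add_mem' := fun {a b} ha hb => by simpa using HasSum.add ha hb
      zero_mem' := by simp
      smul_mem' := fun c a ha => by simpa using HasSum.const_smul c ha } with hD
  have h1 : ∀ (l : ∀ j, ι j) (x : ∀ j, H j), (tprod fun j => P j (l j) (x j)) ∈ D := by
    intro l x
    have h2 : tensorMap (fun j => P j (l j)) (tprod fun j => P j (l j) (x j)) =
        tprod fun j => P j (l j) (x j) := by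
      rw [tensorMap_tprod]
      simp only [← mul_apply_eq_comp, hP]
    have h3 := hasSum_single (f := fun k : ∀ j, ι j => tensorMap (fun j => P j (k j))
      (tprod fun j => P j (l j) (x j))) l fun k hk => by
        obtain ⟨j, hj⟩ := Function.ne_iff.1 hk
        rw [tensorMap_tprod, ← tprodMultilinear_apply]
        refine MultilinearMap.map_coord_zero _ j ?_
        rw [← mul_apply_eq_comp, hP' j _ _ hj, zero_apply]
    simp only [h2] at h3
    exact h3
  have h4 : ∀ x : ∀ j, H j, tprod x ∈ D := by
    intro x
    -- Convergence along boxes is enough here, since it only serves to place `tprod x` in a closed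
    -- set.
    have h5 : Tendsto (fun F : ∀ j, Finset (ι j) => (tprod fun j => ∑ k ∈ F j, P j k (x j) :
        HilbertTensor H)) (Filter.pi fun _ => atTop) (𝓝 (tprod x)) :=
      (continuous_tprod.tendsto x).comp (tendsto_pi_nhds.2 fun j =>
        (hsum j (x j)).comp (tendsto_eval_pi _ j))
    refine hclosed.mem_of_tendsto h5 (Eventually.of_forall fun F => ?_)
    change _ ∈ D
    rw [← tprodMultilinear_apply, MultilinearMap.map_sum_finset]
    exact D.sum_mem fun k _ => h1 k x
  have h6 : Submodule.span ℂ (Set.range (tprod : (∀ j, H j) → HilbertTensor H)) ≤ D :=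
    Submodule.span_le.2 (by rintro _ ⟨x, rfl⟩; exact h4 x)
  have h7 : closure (Submodule.span ℂ (Set.range (tprod : (∀ j, H j) → HilbertTensor H)) :
      Set (HilbertTensor H)) ⊆
      {w | HasSum (fun k : ∀ j, ι j => tensorMap (fun j => P j (k j)) w) w} :=
    closure_minimal h6 hclosed
  exact h7 (dense_span_tprod w)

end TensorSums

/-! ### The functional calculus on the spectral subspaces -/

namespace ProjectorNilpotentDecomposition

variable {H : Type u} [NormedAddCommGroup H] [InnerProductSpace ℂ H] {X : H →L[ℂ] H} {ι : Type v}
  (D : ProjectorNilpotentDecomposition X ι)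

/-- Evaluate the series for `X` on the range of `P l`: for `k ≠ l` both `P k` and `N k = N k * P k`
vanish there. -/
theorem X_mul_P (l : ι) : X * D.P l = D.ev l • D.P l + D.N l := by
  ext x
  have h1 := hasSum_single (f := fun k => (D.ev k • D.P k + D.N k) (D.P l x)) l fun k hk => by
    have h2 : D.P k (D.P l x) = 0 := by
      rw [← mul_apply_eq_comp, D.P_mul_of_ne k l hk, zero_apply]
    have h3 : D.N k (D.P l x) = 0 := by
      rw [← D.N_mul_P k, mul_apply_eq_comp, h2, map_zero]
    rw [add_apply, smul_apply, h2, h3, smul_zero, add_zero]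
  have h4 := (D.hasSum_X (D.P l x)).unique h1
  rw [mul_apply_eq_comp, h4, add_apply, add_apply, smul_apply, smul_apply, ← mul_apply_eq_comp,
    D.P_mul_self, ← mul_apply_eq_comp, D.N_mul_P]

theorem N_eq (l : ι) : D.N l = (X - D.ev l • ContinuousLinearMap.id ℂ H) * D.P l := by
  have h : ContinuousLinearMap.id ℂ H = 1 := rfl
  rw [sub_mul, D.X_mul_P, h, smul_mul_assoc, one_mul, add_sub_cancel_left]

theorem hasEigenvalue_ev (k : ι) : Module.End.HasEigenvalue (X : H →ₗ[ℂ] H) (D.ev k) := by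
  have h : D.ev k ∈ discreteSpectrum X := D.range_ev ▸ Set.mem_range_self k
  exact h.1

theorem ev_mem_spectrum (k : ι) : D.ev k ∈ spectrum ℂ X := by
  obtain ⟨x, hx⟩ := (D.hasEigenvalue_ev k).exists_hasEigenvector
  intro h
  obtain ⟨a, ha⟩ := spectrum.mem_resolventSet_iff.1 h
  have h1 : (a : H →L[ℂ] H) x = 0 := by
    have h2 : X x = D.ev k • x := hx.apply_eq_smul
    rw [ha, Algebra.algebraMap_eq_smul_one, sub_apply, smul_apply, h2]
    simp
  apply hx.2
  have h3 : ((a⁻¹ : (H →L[ℂ] H)ˣ) * a : H →L[ℂ] H) x = x := by rw [Units.inv_mul]; rfl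
  rw [← h3, mul_apply_eq_comp, h1, map_zero]

/-- Nilpotency class `0` would mean `1 = 0`, but an eigenvector exists. -/
theorem one_le_ν (k : ι) : 1 ≤ D.ν k := by
  by_contra! h
  have h0 : D.ν k = 0 := by omega
  obtain ⟨x, hx⟩ := (D.hasEigenvalue_ev k).exists_hasEigenvector
  have h1 : D.N k ^ D.ν k = 0 := pow_nilpotencyClass (D.isNilpotent_N k)
  rw [h0, pow_zero] at h1
  exact hx.2 (by simpa using congrArg (fun T : H →L[ℂ] H => T x) h1)

theorem X_mul_N_pow_mul_P (k : ι) (m : ℕ) : X * (D.N k ^ m * D.P k) =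
    D.ev k • (D.N k ^ m * D.P k) + D.N k ^ (m + 1) * D.P k := by
  cases m with
  | zero => rw [pow_zero, one_mul, zero_add, pow_one, D.X_mul_P, D.N_mul_P]
  | succ m =>
    have h : D.N k ^ (m + 1) = D.P k * D.N k ^ (m + 1) := by
      rw [pow_succ', ← mul_assoc, D.P_mul_N]
    conv_lhs => rw [h, mul_assoc, ← mul_assoc, D.X_mul_P, add_mul, smul_mul_assoc, ← mul_assoc, ← h,
      ← mul_assoc, ← pow_succ']

/-- The resolvent on a spectral subspace. -/
theorem resolvent_mul_P (k : ι) {z : ℂ} (hz : z ∉ spectrum ℂ X) : resolvent X z * D.P k =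
    ∑ m ∈ Finset.range (D.ν k), (z - D.ev k)⁻¹ ^ (m + 1) • (D.N k ^ m * D.P k) := by
  have hne : z - D.ev k ≠ 0 := fun h => hz (sub_eq_zero.1 h ▸ D.ev_mem_spectrum k)
  have hu : IsUnit (algebraMap ℂ (H →L[ℂ] H) z - X) := spectrum.notMem_iff.1 hz
  have h1 : (algebraMap ℂ (H →L[ℂ] H) z - X) *
      ∑ m ∈ Finset.range (D.ν k), (z - D.ev k)⁻¹ ^ (m + 1) • (D.N k ^ m * D.P k) = D.P k := by
    -- Multiplying by `z - X` makes the finite geometric series telescope from `P k` down to the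
    -- vanishing power `N k ^ ν k`.
    have h2 : ∀ m, (algebraMap ℂ (H →L[ℂ] H) z - X) *
        ((z - D.ev k)⁻¹ ^ (m + 1) • (D.N k ^ m * D.P k)) =
        (z - D.ev k)⁻¹ ^ m • (D.N k ^ m * D.P k) -
          (z - D.ev k)⁻¹ ^ (m + 1) • (D.N k ^ (m + 1) * D.P k) := fun m => by
      have h3 : (z - D.ev k)⁻¹ ^ m = (z - D.ev k)⁻¹ ^ (m + 1) * (z - D.ev k) := by
        rw [pow_succ, mul_assoc, inv_mul_cancel₀ hne, mul_one]
      rw [mul_smul_comm, sub_mul, D.X_mul_N_pow_mul_P, Algebra.algebraMap_eq_smul_one,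
        smul_mul_assoc, one_mul, h3]
      module
    have h4 : D.N k ^ D.ν k = 0 := pow_nilpotencyClass (D.isNilpotent_N k)
    rw [Finset.mul_sum, Finset.sum_congr rfl fun m _ => h2 m,
      Finset.sum_range_sub' fun m => (z - D.ev k)⁻¹ ^ m • (D.N k ^ m * D.P k), h4]
    simp
  conv_lhs => rw [← h1]
  rw [← mul_assoc, resolvent, Ring.inverse_mul_cancel _ hu, one_mul]

end ProjectorNilpotentDecomposition

/-! ### Evaluation of the operator-valued Cauchy integral. -/

theorem contourIntegral_mul {r : ℕ} {A : Type*} [NormedRing A] [NormedAlgebra ℂ A]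
    [CompleteSpace A] {Γ : Fin r → Cycle} {F : (Fin r → ℂ) → A}
    (hF : ContinuousOn F (Set.univ.pi fun j => (Γ j).image)) (a : A) :
    contourIntegral Γ F * a = contourIntegral Γ fun z => F z * a := by
  simp only [contourIntegral, Finset.sum_mul]
  refine Finset.sum_congr rfl fun c _ => ?_
  have h := ((ContinuousLinearMap.mul ℂ A).flip a).integral_comp_comm
    (integrableOn_contour_integrand hF c)
  simpa using h.symm

theorem contourIntegral_sum_smul {r : ℕ} {E κ : Type*} [NormedAddCommGroup E] [NormedSpace ℂ E]
    [CompleteSpace E] {Γ : Fin r → Cycle} {s : Finset κ} {g : κ → (Fin r → ℂ) → ℂ}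
    (hg : ∀ α, ContinuousOn (g α) (Set.univ.pi fun j => (Γ j).image)) (v : κ → E) :
    contourIntegral Γ (fun z => ∑ α ∈ s, g α z • v α) =
      ∑ α ∈ s, contourIntegral Γ (g α) • v α := by
  simp only [contourIntegral, Finset.sum_smul]
  rw [Finset.sum_comm]
  refine Finset.sum_congr rfl fun c _ => ?_
  simp only [Finset.smul_sum, ← integral_smul_const]
  rw [← MeasureTheory.integral_finsetSum]
  · simp only [smul_assoc]
  · intro α _
    exact (integrableOn_contour_integrand (hg α) c).smul_const (v α)

section Calculus

variable {r : ℕ} {H : Fin r → Type u} [∀ j, NormedAddCommGroup (H j)]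
  [∀ j, InnerProductSpace ℂ (H j)] {X : ∀ j, H j →L[ℂ] H j}
  {ι : Fin r → Type v} {Ω : Set (Fin r → ℂ)} {f : (Fin r → ℂ) → ℂ} {Γ : Fin r → Cycle}

/-- Admissible contours exist. -/
theorem exists_isAdmissible [∀ j, CompleteSpace (H j)]
    (hΩ : IsOpen Ω) (hσ : Set.univ.pi (fun j => spectrum ℂ (X j)) ⊆ Ω) :
    ∃ Γ, IsAdmissible X Ω Γ := by
  have hc : ∀ j, IsCompact (spectrum ℂ (X j)) := fun j => spectrum.isCompact _
  -- In the sup metric a product of `δ`-thickenings lies in the `δ`-thickening of the product, so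
  -- one `δ` serves all factors.
  obtain ⟨δ, hδ, h⟩ := (isCompact_univ_pi hc).exists_thickening_subset_open hΩ hσ
  have hsub := fun j => Metric.self_subset_thickening hδ (spectrum ℂ (X j))
  choose Γ hΓ _ using fun j => Grid.exists_cycle (hc j) Metric.isOpen_thickening (hsub j)
  refine ⟨Γ, _, fun j => Metric.isOpen_thickening, hsub, fun z hz => h ?_, hΓ⟩
  choose w hw hzw using fun j => Metric.mem_thickening_iff.1 (hz j trivial)
  exact Metric.mem_thickening_iff.2 ⟨w, fun j _ => hw j, (dist_pi_lt_iff hδ).2 hzw⟩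

/-- The Cauchy integral on a product of spectral subspaces. -/
theorem cauchyIntegral_mul_tensorMap (D : ∀ j, ProjectorNilpotentDecomposition (X j) (ι j))
    (hf : AnalyticOnNhd ℂ f Ω) (hΓ : IsAdmissible X Ω Γ) (k : ∀ j, ι j) :
    cauchyIntegral X f Γ * tensorMap (fun j => (D j).P (k j)) =
      ∑ α ∈ Fintype.piFinset (fun j => Finset.range ((D j).ν (k j))),
        (mixedPartial α f (fun j => (D j).ev (k j)) / ((∏ j, (α j)! : ℕ) : ℂ)) •
          tensorMap (fun j => (D j).N (k j) ^ α j * (D j).P (k j)) := by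
  obtain ⟨U, hU, hσU, hUΩ, hsur⟩ := hΓ
  have himage : ∀ j, ∀ z ∈ (Γ j).image, z ∈ U j \ spectrum ℂ (X j) := fun j z hz => by
    obtain ⟨i, t, ht, rfl⟩ := Set.mem_iUnion.1 hz
    exact (hsur j).mem i t ht
  have hev := fun j => (D j).ev_mem_spectrum (k j)
  have hevΓ : ∀ j, (D j).ev (k j) ∉ (Γ j).image := fun j h => (himage j _ h).2 (hev j)
  have hfc : ContinuousOn f (Set.univ.pi fun j => (Γ j).image) :=
    hf.continuousOn.mono fun z hz => hUΩ fun j hj => (himage j _ (hz j hj)).1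
  have hres : ContinuousOn (fun z : Fin r → ℂ =>
      f z • (List.ofFn fun j => resolvent (lift j (X j)) (z j)).prod)
      (Set.univ.pi fun j => (Γ j).image) := by
    simp only [List.ofFn_eq_map]
    refine hfc.smul (continuousOn_list_prod _ fun j _ => ?_)
    have h1 : ContinuousOn (resolvent (lift j (X j))) (Γ j).image := fun z hz =>
      (spectrum.hasDerivAt_resolvent_const_left (not_not.1
        (notMem_spectrum_lift j (X j) (himage j z hz).2))).continuousAt.continuousWithinAt
    exact h1.comp (continuous_apply j).continuousOn fun z hz => hz j trivial
  have hg : ∀ α : Fin r → ℕ, ContinuousOn (fun z : Fin r → ℂ =>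
      f z * ∏ j, (z j - (D j).ev (k j))⁻¹ ^ (α j + 1)) (Set.univ.pi fun j => (Γ j).image) :=
    fun α => hfc.mul <| continuousOn_finsetProd _ fun j _ => by
      have h1 : ContinuousOn (fun z : Fin r → ℂ => (z j - (D j).ev (k j))⁻¹)
          (Set.univ.pi fun j => (Γ j).image) :=
        (Cycle.continuousOn_inv_sub (hevΓ j)).comp (continuous_apply j).continuousOn
          fun z hz => hz j trivial
      exact h1.pow _
  -- Off the spectra, the product of lifted resolvents is the tensor product of the resolvents.
  -- Times the projectors, each factor is a finite sum, and multilinearity expands the whole.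
  have hint : Set.EqOn (fun z : Fin r → ℂ =>
      (f z • (List.ofFn fun j => resolvent (lift j (X j)) (z j)).prod) *
        tensorMap (fun j => (D j).P (k j)))
      (fun z => ∑ α ∈ Fintype.piFinset (fun j => Finset.range ((D j).ν (k j))),
        (f z * ∏ j, (z j - (D j).ev (k j))⁻¹ ^ (α j + 1)) •
          tensorMap (fun j => (D j).N (k j) ^ α j * (D j).P (k j)))
      (Set.univ.pi fun j => (Γ j).image) := fun z hz => by
    have h1 : ∀ j, z j ∉ spectrum ℂ (X j) := fun j => (himage j _ (hz j trivial)).2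
    simp only [resolvent_lift _ _ (h1 _), prod_ofFn_lift, smul_mul_assoc]
    rw [← tensorMap_mul]
    simp only [(D _).resolvent_mul_P (k _) (h1 _), tensorMap_sum_smul, Finset.smul_sum, smul_smul]
  rw [cauchyIntegral, smul_mul_assoc, contourIntegral_mul hres, contourIntegral_congr hint,
    contourIntegral_sum_smul hg, Finset.smul_sum]
  refine Finset.sum_congr rfl fun α _ => ?_
  rw [contourIntegral_mul_prod_inv_sub_pow hU (fun j z hz => (himage j z hz).1)
    (fun j => (hsur j).index_eq_zero) (fun j => hσU j (hev j)) hevΓ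
    (fun j => (hsur j).index_eq_one _ (hev j)) α (hf.mono hUΩ), smul_smul, ← mul_assoc,
    inv_mul_cancel₀ (pow_ne_zero r Complex.two_pi_I_ne_zero), one_mul]

/-- The Cauchy integral as an unconditionally convergent series. -/
theorem hasSum_cauchyIntegral [∀ j, CompleteSpace (H j)]
    (D : ∀ j, ProjectorNilpotentDecomposition (X j) (ι j))
    (hf : AnalyticOnNhd ℂ f Ω) (hΓ : IsAdmissible X Ω Γ) (w : HilbertTensor H) :
    HasSum (fun k : ∀ j, ι j => ∑ α ∈ Fintype.piFinset (fun j => Finset.range ((D j).ν (k j))),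
      (mixedPartial α f (fun j => (D j).ev (k j)) / ((∏ j, (α j)! : ℕ) : ℂ)) •
        tensorMap (fun j => (D j).N (k j) ^ α j * (D j).P (k j)) w) (cauchyIntegral X f Γ w) := by
  have h := (hasSum_tensorMap (P := fun j => (D j).P) (fun j => (D j).P_mul_self)
    (fun j => (D j).P_mul_of_ne) (fun j => (D j).hasSum_P) w).mapL (cauchyIntegral X f Γ)
  convert h using 2 with k
  rw [← mul_apply_eq_comp, cauchyIntegral_mul_tensorMap D hf hΓ, sum_apply]
  rfl

/-- Both integrals are sums of the same series, which does not involve the contours; no deformation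
of contours is needed. -/
theorem tensorCalculus_eq [∀ j, CompleteSpace (H j)]
    (D : ∀ j, ProjectorNilpotentDecomposition (X j) (ι j))
    (hf : AnalyticOnNhd ℂ f Ω) (hΓ : IsAdmissible X Ω Γ) :
    cauchyIntegral X f Γ = tensorCalculus X Ω f := by
  have h : ∃ Γ, IsAdmissible X Ω Γ := ⟨Γ, hΓ⟩
  rw [tensorCalculus, dif_pos h]
  ext w
  exact (hasSum_cauchyIntegral D hf hΓ w).unique (hasSum_cauchyIntegral D hf h.choose_spec w)

end Calculus

/-- A sum over multi-indices, ordered by their supports. -/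
theorem sum_support_piFinset {r : ℕ} {V : Type*} [AddCommMonoid V] (n : Fin r → ℕ)
    (hn : ∀ j, 1 ≤ n j) (g : (Fin r → ℕ) → V) :
    ∑ A : Finset (Fin r), ∑ q ∈ Fintype.piFinset
        (fun j => if j ∈ A then Finset.Icc 1 (n j - 1) else {0}), g q =
      ∑ q ∈ Fintype.piFinset (fun j => Finset.range (n j)), g q := by
  -- The multi-indices are grouped by their support. Since `n j ≥ 1`, the value `0` is available at
  -- every `j` outside `A`.
  rw [← Finset.sum_fiberwise (Fintype.piFinset fun j => Finset.range (n j))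
    fun q => Finset.univ.filter fun j => q j ≠ 0]
  refine Finset.sum_congr rfl fun A _ => Finset.sum_congr ?_ fun _ _ => rfl
  ext q
  simp only [Fintype.mem_piFinset, Finset.mem_filter, Finset.ext_iff, Finset.mem_univ, true_and,
    Finset.mem_range, ← forall_and]
  refine forall_congr' fun j => ?_
  have := hn j
  by_cases hj : j ∈ A
  · simp only [hj, if_true, Finset.mem_Icc, iff_true]
    omega
  · simp only [hj, if_false, Finset.mem_singleton, iff_false]
    omega

end TensorCalculus

end

/-! ### The two forms of the spectral expansion. -/

theorem mainTheorem6 {r : ℕ} {H : Fin r → Type*} [∀ j, NormedAddCommGroup (H j)]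
    [∀ j, InnerProductSpace ℂ (H j)] [∀ j, CompleteSpace (H j)]
    (X : ∀ j, H j →L[ℂ] H j)
    {ι : Fin r → Type*}
    (D : ∀ j, TensorCalculus.ProjectorNilpotentDecomposition (X j) (ι j))
    (Ω : Set (Fin r → ℂ)) (hΩ : IsOpen Ω)
    (hσ : Set.univ.pi (fun j => spectrum ℂ (X j)) ⊆ Ω)
    (f : (Fin r → ℂ) → ℂ) (hf : AnalyticOnNhd ℂ f Ω) :
    -- the calculus is well defined: contours exist, and the Cauchy integral does not depend on them
    (∃ Γ, TensorCalculus.IsAdmissible X Ω Γ) ∧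
    (∀ Γ, TensorCalculus.IsAdmissible X Ω Γ →
      TensorCalculus.cauchyIntegral X f Γ = TensorCalculus.tensorCalculus X Ω f) ∧
    (∀ j k, (D j).N k =
      (X j - (D j).ev k • ContinuousLinearMap.id ℂ (H j)) * (D j).P k) ∧
    -- the formula with subsets `A`
    (∀ u : TensorCalculus.HilbertTensor H, HasSum
      (fun k : ∀ j, ι j => ∑ A : Finset (Fin r),
        ∑ q ∈ Fintype.piFinset
          (fun j => if j ∈ A then Finset.Icc 1 ((D j).ν (k j) - 1) else {0}),
          (TensorCalculus.mixedPartial q f (fun j => (D j).ev (k j)) /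
              ((∏ j ∈ A, (q j)! : ℕ) : ℂ)) •
            TensorCalculus.tensorMap (fun j =>
              if j ∈ A then (D j).N (k j) ^ q j * (D j).P (k j) else (D j).P (k j)) u)
      (TensorCalculus.tensorCalculus X Ω f u)) ∧
    -- the formula with multi-indices `α`
    (∀ u : TensorCalculus.HilbertTensor H, HasSum
      (fun k : ∀ j, ι j =>
        ∑ α ∈ Fintype.piFinset (fun j => Finset.range ((D j).ν (k j))),
          (TensorCalculus.mixedPartial α f (fun j => (D j).ev (k j)) /
              ((∏ j, (α j)! : ℕ) : ℂ)) •
            TensorCalculus.tensorMap (fun j => (D j).N (k j) ^ α j * (D j).P (k j)) u)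
      (TensorCalculus.tensorCalculus X Ω f u)) := by
  obtain ⟨Γ, hΓ⟩ := TensorCalculus.exists_isAdmissible hΩ hσ
  have hsum : ∀ u : TensorCalculus.HilbertTensor H, HasSum
      (fun k : ∀ j, ι j =>
        ∑ α ∈ Fintype.piFinset (fun j => Finset.range ((D j).ν (k j))),
          (TensorCalculus.mixedPartial α f (fun j => (D j).ev (k j)) /
              ((∏ j, (α j)! : ℕ) : ℂ)) •
            TensorCalculus.tensorMap (fun j => (D j).N (k j) ^ α j * (D j).P (k j)) u)
      (TensorCalculus.tensorCalculus X Ω f u) := fun u => by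
    rw [← TensorCalculus.tensorCalculus_eq D hf hΓ]
    exact TensorCalculus.hasSum_cauchyIntegral D hf hΓ u
  refine ⟨⟨Γ, hΓ⟩, fun Γ hΓ => TensorCalculus.tensorCalculus_eq D hf hΓ,
    fun j k => (D j).N_eq k, fun u => ?_, hsum⟩
  convert hsum u using 2 with k
  rw [← TensorCalculus.sum_support_piFinset (fun j => (D j).ν (k j))
    fun j => (D j).one_le_ν (k j)]
  refine Finset.sum_congr rfl fun A _ => Finset.sum_congr rfl fun q hq => ?_
  -- Outside `A` the exponent is zero, so the extra factorials are `1` and `N ^ 0 * P = P`; the two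
  -- summands agree.
  have hq0 : ∀ j, j ∉ A → q j = 0 := fun j hj => by
    simpa [hj] using Fintype.mem_piFinset.1 hq j
  have h1 : ∏ j ∈ A, (q j)! = ∏ j, (q j)! :=
    Finset.prod_subset (Finset.subset_univ A) fun j _ hj => by rw [hq0 j hj, Nat.factorial_zero]
  have h2 : (fun j => if j ∈ A then (D j).N (k j) ^ q j * (D j).P (k j) else (D j).P (k j)) =
      fun j => (D j).N (k j) ^ q j * (D j).P (k j) := by
    funext j
    split_ifs with hj
    · rfl
    · rw [hq0 j hj, pow_zero, one_mul]
  rw [h1, h2]
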